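/- **Setting.** $n\ge 2$ agents divide a dollar over periods $t=0,1,2,\dots$. In each period every agent $i$ exerts effort $x_i\ge 0$ at cost $c_i(x_i)$; agent $i$ is recognized as proposer with probability $p_i(x)=\tilde f_i(x_i)/\sum_j\tilde f_j(x_j)$ if the sum is positive and $1/n$ otherwise, where $\tilde f_i=\alpha_i f_i+\beta_i$. The proposer offers a division in the simplex, the others vote, and the proposal is approved if at least $k$ agents, including the proposer, are in favor; otherwise the game moves to the next period. If approval occurs at $\tau$, agent $i$'s payoff is $\delta_i^{\tau}s_{i,\tau}-\sum_{t\le\tau}\delta_i^tc_i(x_{i,t})$ (only the costs, if there is never an agreement), with $\delta_i\in(0,1)$. A rule is a triple $(\alpha,\beta,k)$ with $\alpha\in\mathbb R_+^n\setminus\{0\}$, $\beta\in\mathbb R_+^n$, $1\le k\le n$. An equilibrium is a stationary subgame perfect equilibrium in which efforts are pure, proposals may be random, and each non-proposer accepts if and only if his share is at least $\delta_iv_i$, where $v_i$ is his equilibrium payoff. An outcome of a rule is the pair $(x,p)$ of efforts and recognition probabilities of one of its equilibria. **Assumptions.** For each $i$, $f_i$ and $c_i$ are continuous on $[0,\infty)$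 and twice differentiable on $(0,\infty)$, with $f_i(0)=c_i(0)=0$, $f_i'>0$, $f_i''\le0$, $c_i'>0$, $c_i''\ge0$. The designer's objective $\Lambda(x,p)$ is, for fixed $p$, weakly increasing in each $x_i$. **Theorem 2.** 1. For every rule and every outcome $(x,p)$ of it there is a rule with $k=1$ whose unique outcome is $(x,p)$. 2. For every rule and every outcome $(x,p)$ of it with $p_i<1$ for all $i$ there is a rule with $k=1$ and $\beta=0$ whose unique outcome $(\hat x,p)$ has the same $p$ and satisfies $\hat x\ge x$, hence $\Lambda(\hat x,p)\ge\Lambda(x,p)$. 3. Consequently, if $\Lambda$ has a maximum over all outcomes of all rules, attained at $(x,p)$, then it is attained as the unique outcome of a rule with $k=1$; and if $p_i<1$ for all $i$, it is attained at the unique outcome of a rule with $k=1$ and $\beta=0$. 4. If $\Lambda$ is continuous, a maximum exists and is attained as the unique outcome $(x,p)$ of a rule with $k=1$ such that $\beta=0$ or $p_i=1$ for some $i$; in either case its value is the supremum of $\Lambda$ over the outcomes of rules with $k=1$ and $\beta=0$. -/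

import Mathlib

open scoped NNReal
open Filter Topology

noncomputable section

namespace Bargaining

/-- The primitives of the model: production technologies `f`, effort cost functions `c` and
discount factors `δ`. Only the values of `f i` and `c i` on `[0, ∞)` matter. -/
structure Environment (n : ℕ) where
  f : Fin n → ℝ → ℝ
  c : Fin n → ℝ → ℝ
  δ : Fin n → ℝ

/-- The regularity assumption on technologies and costs. Continuity on `[0, ∞)` is only a
condition at `0`. -/
structure Environment.Regular {n : ℕ} (E : Environment n) : Prop where
  f_cont : ∀ i, ContinuousOn (E.f i) (Set.Ici 0)
  f_zero : ∀ i, E.f i 0 = 0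
  f_diff : ∀ i, DifferentiableOn ℝ (E.f i) (Set.Ioi 0)
  f_diff₂ : ∀ i, DifferentiableOn ℝ (deriv (E.f i)) (Set.Ioi 0)
  f_deriv_pos : ∀ i, ∀ x, 0 < x → 0 < deriv (E.f i) x
  f_deriv₂_nonpos : ∀ i, ∀ x, 0 < x → deriv (deriv (E.f i)) x ≤ 0
  c_cont : ∀ i, ContinuousOn (E.c i) (Set.Ici 0)
  c_zero : ∀ i, E.c i 0 = 0
  c_diff : ∀ i, DifferentiableOn ℝ (E.c i) (Set.Ioi 0)
  c_diff₂ : ∀ i, DifferentiableOn ℝ (deriv (E.c i)) (Set.Ioi 0)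
  c_deriv_pos : ∀ i, ∀ x, 0 < x → 0 < deriv (E.c i) x
  c_deriv₂_nonneg : ∀ i, ∀ x, 0 < x → 0 ≤ deriv (deriv (E.c i)) x

/-- An organizational rule `(α, β, k)`: multiplicative biases `α ∈ ℝ₊ⁿ \ {0}`, headstarts
`β ∈ ℝ₊ⁿ` and a `k`-majority voting rule. -/
structure Rule (n : ℕ) where
  α : Fin n → ℝ
  β : Fin n → ℝ
  k : ℕ
  α_nonneg : ∀ i, 0 ≤ α i
  α_ne_zero : α ≠ 0
  β_nonneg : ∀ i, 0 ≤ β i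
  one_le_k : 1 ≤ k
  k_le : k ≤ n

/-- The impact function `α_i f_i + β_i`. -/
def impact {n : ℕ} (E : Environment n) (r : Rule n) (i : Fin n) (x : ℝ≥0) : ℝ :=
  r.α i * E.f i x + r.β i

open Classical in
/-- The probability that agent `i` is recognized as proposer, given efforts `x`. -/
def recognition {n : ℕ} (E : Environment n) (r : Rule n) (x : Fin n → ℝ≥0) (i : Fin n) : ℝ :=
  if 0 < ∑ j, impact E r j (x j) then impact E r i (x i) / ∑ j, impact E r j (x j)
  else 1 / (n : ℝ)

/-! ### The extensive form -/

/-- A division of the dollar. -/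
abbrev Division (n : ℕ) : Type := stdSimplex ℝ (Fin n)

/-- A finitely supported lottery. -/
structure Lottery (A : Type) where
  weight : A →₀ ℝ
  nonneg : ∀ a, 0 ≤ weight a
  total : (weight.sum fun _ q => q) = 1

/-- The expectation of `g` under a lottery. -/
def Lottery.expect {A : Type} (L : Lottery A) (g : A → ℝ) : ℝ :=
  L.weight.sum fun a q => q * g a

/-- What is observed in a period: the efforts, the recognized proposer, the proposal and the set
of agents in favor of it. -/
structure Round (n : ℕ) where
  effort : Fin n → ℝ≥0
  proposer : Fin n
  offer : Division n
  favor : Finset (Fin n)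

/-- A history at the beginning of a period: the list of all past (failed) rounds. -/
abbrev History (n : ℕ) : Type := List (Round n)

/-- A strategy of one agent: an effort at the beginning of every period, a (possibly random)
proposal in case of being recognized, and a vote on every proposal of every other agent.
Actions may depend on the past rounds and on everything that happened in the current period. -/
structure Strategy (n : ℕ) where
  effort : History n → ℝ≥0
  propose : History n → (Fin n → ℝ≥0) → Lottery (Division n)
  vote : History n → (Fin n → ℝ≥0) → Fin n → Division n → Bool

/-- A strategy profile. -/
abbrev Profile (n : ℕ) : Type := Fin n → Strategy n

/-- The agents in favor of proposal `s` of agent `j`; the proposer always is. -/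
def favor {n : ℕ} (σ : Profile n) (h : History n) (x : Fin n → ℝ≥0) (j : Fin n)
    (s : Division n) : Finset (Fin n) :=
  Finset.univ.filter fun m => m = j ∨ (σ m).vote h x j s = true

/-- The payoff of agent `i`, seen from the voting stage on proposal `s` of agent `j`, if `U` gives
his payoffs from the beginning of the next period on. -/
def voteStage {n : ℕ} (E : Environment n) (r : Rule n) (σ : Profile n) (i : Fin n)
    (U : History n → ℝ) (h : History n) (x : Fin n → ℝ≥0) (j : Fin n) (s : Division n) : ℝ :=
  if r.k ≤ (favor σ h x j s).card then s.1 i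
  else E.δ i * U (h ++ [⟨x, j, s, favor σ h x j s⟩])

/-- The expected payoff of agent `i` when agent `j` has been recognized and is about to propose. -/
def proposeStage {n : ℕ} (E : Environment n) (r : Rule n) (σ : Profile n) (i : Fin n)
    (U : History n → ℝ) (h : History n) (x : Fin n → ℝ≥0) (j : Fin n) : ℝ :=
  ((σ j).propose h x).expect fun s => voteStage E r σ i U h x j s

/-- The expected discounted payoff of agent `i` from the beginning of the period after history `h`
on, collected over the next `T` periods: the expectation of the share received, discounted, if a
proposal is approved within these periods, minus the discounted effort costs until then. -/
def value {n : ℕ} (E : Environment n) (r : Rule n) (σ : Profile n) (i : Fin n) :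
    ℕ → History n → ℝ
  | 0, _ => 0
  | T + 1, h =>
      -E.c i ((σ i).effort h) +
        ∑ j, recognition E r (fun m => (σ m).effort h) j *
          proposeStage E r σ i (value E r σ i T) h (fun m => (σ m).effort h) j

/-- The nodes of the game: the beginning of a period, the proposal of agent `j` after efforts `x`,
and the vote on proposal `s` of agent `j` after efforts `x`. -/
inductive Node (n : ℕ) where
  | start (h : History n)
  | propose (h : History n) (x : Fin n → ℝ≥0) (j : Fin n)
  | vote (h : History n) (x : Fin n → ℝ≥0) (j : Fin n) (s : Division n)

/-- Expected payoff of agent `i` from a node on, with only finitely many further periods. -/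
def nodeValue {n : ℕ} (E : Environment n) (r : Rule n) (σ : Profile n) (i : Fin n) (T : ℕ) :
    Node n → ℝ
  | .start h => value E r σ i T h
  | .propose h x j => proposeStage E r σ i (value E r σ i T) h x j
  | .vote h x j s => voteStage E r σ i (value E r σ i T) h x j s

/-- `u` is the expected discounted payoff of agent `i` from the node `N` on, in the game with
infinite horizon. The limit exists in `[-∞, 1]`; a strategy whose costs make it `-∞` has no payoff
`u` here, and is never a profitable deviation. -/
def HasPayoff {n : ℕ} (E : Environment n) (r : Rule n) (σ : Profile n) (i : Fin n) (N : Node n)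
    (u : ℝ) : Prop :=
  Tendsto (fun T => nodeValue E r σ i T N) atTop (𝓝 u)

/-- Subgame perfection: at no node has any agent a profitable deviation to any strategy. -/
def IsSubgamePerfect {n : ℕ} (E : Environment n) (r : Rule n) (σ : Profile n) : Prop :=
  ∀ (N : Node n) (i : Fin n), ∃ u, HasPayoff E r σ i N u ∧
    ∀ (τ : Strategy n) (u' : ℝ), HasPayoff E r (Function.update σ i τ) i N u' → u' ≤ u

/-- Stationarity: constant effort, a constant proposal lottery, and votes that depend only on the
proposer and the proposal. -/
def Strategy.IsStationary {n : ℕ} (τ : Strategy n) : Prop :=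
  (∀ h h', τ.effort h = τ.effort h') ∧
  (∀ h x h' x', τ.propose h x = τ.propose h' x') ∧
  (∀ h x h' x' j s, τ.vote h x j s = τ.vote h' x' j s)

/-- Stage-undominated voting: an agent who is not the proposer votes as if he were pivotal, that
is, he accepts if and only if his share is at least his discounted continuation value. -/
def VotesAsPivotal {n : ℕ} (E : Environment n) (r : Rule n) (σ : Profile n) : Prop :=
  ∃ v : Fin n → ℝ, (∀ i, HasPayoff E r σ i (.start []) (v i)) ∧
    ∀ i h x j s, j ≠ i → ((σ i).vote h x j s = true ↔ E.δ i * v i ≤ s.1 i)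

/-- Stationary subgame perfect equilibrium (in stage-undominated voting strategies). -/
def IsSSPE {n : ℕ} (E : Environment n) (r : Rule n) (σ : Profile n) : Prop :=
  (∀ i, (σ i).IsStationary) ∧ IsSubgamePerfect E r σ ∧ VotesAsPivotal E r σ

/-! ### The design problem -/

/-- `(x, p)` are the efforts and recognition probabilities of some equilibrium under rule `r`. -/
def IsOutcome {n : ℕ} (E : Environment n) (r : Rule n) (x : Fin n → ℝ≥0) (p : Fin n → ℝ) : Prop :=
  (∃ σ, IsSSPE E r σ ∧ ∀ i h, (σ i).effort h = x i) ∧ p = recognition E r x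

/-- `(x, p)` is the only equilibrium outcome under rule `r`. -/
def IsUniqueOutcome {n : ℕ} (E : Environment n) (r : Rule n) (x : Fin n → ℝ≥0) (p : Fin n → ℝ) :
    Prop :=
  IsOutcome E r x p ∧ ∀ x' p', IsOutcome E r x' p' → x' = x ∧ p' = p

/-- The rule `r` with its equilibrium outcome `(x, p)` maximizes the objective `Λ` over all rules
and all their equilibria. -/
def IsOptimal {n : ℕ} (E : Environment n) (Λ : (Fin n → ℝ≥0) → (Fin n → ℝ) → ℝ) (r : Rule n)
    (x : Fin n → ℝ≥0) (p : Fin n → ℝ) : Prop :=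
  IsOutcome E r x p ∧ ∀ r' x' p', IsOutcome E r' x' p' → Λ x' p' ≤ Λ x p

/-- For a fixed recognition profile, the objective weakly increases with each effort. -/
def EffortMonotone {n : ℕ} (Λ : (Fin n → ℝ≥0) → (Fin n → ℝ) → ℝ) : Prop :=
  ∀ p ∈ stdSimplex ℝ (Fin n), ∀ (x : Fin n → ℝ≥0) (i : Fin n) (y : ℝ≥0), x i ≤ y →
    Λ x p ≤ Λ (Function.update x i y) p

end Bargaining

end

noncomputable section

namespace Bargaining

section


/-! ### Lotteries -/

/-! An equilibrium is reduced to a contest. If `u i j` is agent `i`'s payoff when `j` proposes,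
changing his effort changes his own recognition probability but not the relative probabilities of
the others. So he competes for a prize `W_i` (`prize`): `u i i` minus his expected payoff
conditional on not being recognized. Shares are nonnegative and sum to at most one, hence `W_i ≤ 1`.
Since `f` is concave and `c` convex, optimality implies the linear condition `W_i⁺ α_i (1 - p_i) / S
* (f y - f x) ≤ c y - c x`, with `S` the total impact (`IsStationaryPayoff.linearized`).

With `k = 1` a proposer keeps the whole dollar and every prize is one. Equilibria are then exactly
the solutions of this condition with `W_i = 1` (`IsContestEq`), and there is at most one
(`IsContestEq.unique_of_le`). So any outcome with all `p_i < 1` is reproduced with `k = 1` by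
scaling `α_i` down to `W_i⁺ α_i` and raising the headstart to keep the impact at `x_i` unchanged;
the new headstart is nonnegative because `W_i ≤ 1`. The new `α` is nonzero by
`IsStationaryPayoff.exists_prize_pos`, which rests on discounting. If some `p_i = 1`, all efforts
are zero and a dictatorship gives the outcome.

For headstarts, fix `p`. From `α_i f_i(x_i) ≤ p_i S`, the coefficient on `f` is at most `p_i (1 -
p_i) / f_i(x_i)`, with equality when `β_i = 0`. Equality amounts to `f c' / f' = p_i (1 - p_i)`,
whose left side is an increasing bijection of `[0, ∞)`. Its inverse gives efforts `contestEffort p`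
that dominate all efforts compatible with `p`, are implementable with `β = 0` if every `p_i < 1`,
and are continuous in `p`. The design problem thus becomes maximization of `Λ (contestEffort p) p`
over the compact simplex. At a vertex `contestEffort` vanishes, matching the dictatorship outcome;
the value there is approached from points with all `p_i < 1`. -/

theorem Lottery.expect_mono {A : Type} (L : Lottery A) {g g' : A → ℝ} (h : ∀ a, g a ≤ g' a) :
    L.expect g ≤ L.expect g' :=
  Finset.sum_le_sum fun a _ => mul_le_mul_of_nonneg_left (h a) (L.nonneg a)

theorem Lottery.expect_const {A : Type} (L : Lottery A) (b : ℝ) :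
    L.expect (fun _ => b) = b := by
  have h := L.total
  simp only [Lottery.expect, Finsupp.sum] at h ⊢
  rw [← Finset.sum_mul, h, one_mul]

theorem Lottery.sum_expect {A ι : Type} [Fintype ι] (L : Lottery A) (g : ι → A → ℝ) :
    ∑ i, L.expect (g i) = L.expect fun a => ∑ i, g i a := by
  simp only [Lottery.expect, Finsupp.sum]
  rw [Finset.sum_comm]
  simp only [Finset.mul_sum]

theorem Lottery.tendsto_expect {A : Type} (L : Lottery A) {g : ℕ → A → ℝ} {g' : A → ℝ}
    (h : ∀ a, Tendsto (fun T => g T a) atTop (𝓝 (g' a))) :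
    Tendsto (fun T => L.expect (g T)) atTop (𝓝 (L.expect g')) :=
  tendsto_finsetSum _ fun a _ => (h a).const_mul _

/-- The lottery that selects `a` with certainty. -/
def Lottery.dirac {A : Type} (a : A) : Lottery A where
  weight := Finsupp.single a 1
  nonneg b := by
    classical
    rw [Finsupp.single_apply]
    split_ifs <;> norm_num
  total := by simp

theorem Lottery.expect_dirac {A : Type} (a : A) (g : A → ℝ) : (Lottery.dirac a).expect g = g a := by
  simp [Lottery.expect, Lottery.dirac]

/-! ### Stages of the game -/

variable {n : ℕ} {E : Environment n} {r : Rule n}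

theorem proposer_mem_favor (σ : Profile n) (h : History n) (x : Fin n → ℝ≥0) (j : Fin n)
    (s : Division n) : j ∈ favor σ h x j s := by
  simp [favor]

theorem voteStage_of_k_eq_one (hk : r.k = 1) (σ : Profile n) (i : Fin n) (U : History n → ℝ)
    (h : History n) (x : Fin n → ℝ≥0) (j : Fin n) (s : Division n) :
    voteStage E r σ i U h x j s = s.1 i := by
  rw [voteStage, if_pos]
  rw [hk]
  exact Finset.card_pos.2 ⟨j, proposer_mem_favor σ h x j s⟩

theorem proposeStage_of_k_eq_one (hk : r.k = 1) (σ : Profile n) (i : Fin n) (U : History n → ℝ)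
    (h : History n) (x : Fin n → ℝ≥0) (j : Fin n) :
    proposeStage E r σ i U h x j = ((σ j).propose h x).expect fun s => s.1 i := by
  simp only [proposeStage, voteStage_of_k_eq_one hk]

theorem proposeStage_congr {σ σ' : Profile n} (hp : ∀ m, (σ m).propose = (σ' m).propose)
    (hv : ∀ m, (σ m).vote = (σ' m).vote) {U U' : History n → ℝ} {h : History n}
    (hU : ∀ R, U (h ++ [R]) = U' (h ++ [R])) (i : Fin n) (x : Fin n → ℝ≥0) (j : Fin n) :
    proposeStage E r σ i U h x j = proposeStage E r σ' i U' h x j := by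
  have hf : ∀ s, favor σ h x j s = favor σ' h x j s := fun s => by
    ext m
    simp [favor, hv]
  simp only [proposeStage, voteStage, hf, hp, hU]

/-- The expected payoff of agent `i` when agent `j` proposes, under a stationary profile with
continuation value `b` for agent `i`. -/
def stagePayoff (E : Environment n) (r : Rule n) (σ : Profile n) (i j : Fin n) (b : ℝ) : ℝ :=
  proposeStage E r σ i (fun _ => b) [] 0 j

/-- Under stationarity, history and current efforts matter only through the continuation value, so
the empty history and zero efforts serve as a representative node. -/
theorem proposeStage_eq_stagePayoff {σ : Profile n} (hσ : ∀ i, (σ i).IsStationary)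
    {U : History n → ℝ} {h : History n} {b : ℝ} (hU : ∀ R, U (h ++ [R]) = b) (i : Fin n)
    (x : Fin n → ℝ≥0) (j : Fin n) :
    proposeStage E r σ i U h x j = stagePayoff E r σ i j b := by
  have hf : ∀ s, favor σ h x j s = favor σ [] 0 j s := fun s => by
    ext m
    simp [favor, (hσ m).2.2 h x [] 0]
  simp only [stagePayoff, proposeStage, voteStage, hU, hf, (hσ j).2.1 h x [] 0]

theorem tendsto_stagePayoff (σ : Profile n) (i j : Fin n) {V : ℕ → ℝ} {v : ℝ}
    (hV : Tendsto V atTop (𝓝 v)) :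
    Tendsto (fun T => stagePayoff E r σ i j (V T)) atTop (𝓝 (stagePayoff E r σ i j v)) := by
  refine Lottery.tendsto_expect _ fun s => ?_
  simp only [voteStage]
  split_ifs
  · exact tendsto_const_nhds
  · exact hV.const_mul _

theorem value_eq_value_nil {σ : Profile n} (hσ : ∀ i, (σ i).IsStationary) (i : Fin n) (T : ℕ)
    (h : History n) : value E r σ i T h = value E r σ i T [] := by
  induction T generalizing h with
  | zero => rfl
  | succ T ih =>
    have he : ∀ m, (σ m).effort h = (σ m).effort [] := fun m => (hσ m).1 _ _
    simp only [value, he]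
    congr 1
    refine Finset.sum_congr rfl fun j _ => ?_
    rw [proposeStage_eq_stagePayoff hσ (fun R => ih _) i _ j,
      proposeStage_eq_stagePayoff hσ (fun R => ih _) i _ j]

theorem value_succ_of_stationary {σ : Profile n} (hσ : ∀ i, (σ i).IsStationary)
    {x : Fin n → ℝ≥0} (hx : ∀ i h, (σ i).effort h = x i) (i : Fin n) (T : ℕ) :
    value E r σ i (T + 1) [] = -E.c i (x i) +
      ∑ j, recognition E r x j * stagePayoff E r σ i j (value E r σ i T []) := by
  simp only [value, hx]
  congr 1
  refine Finset.sum_congr rfl fun j _ => ?_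
  rw [proposeStage_eq_stagePayoff hσ (fun R => value_eq_value_nil hσ i T _) i _ j]

/-- Efforts `x` of a stationary equilibrium together with the payoffs `v i` and the payoffs `u i j`
of agent `i` conditional on agent `j` proposing. -/
structure IsStationaryPayoff (E : Environment n) (r : Rule n) (x : Fin n → ℝ≥0)
    (u : Fin n → Fin n → ℝ) (v : Fin n → ℝ) : Prop where
  v_eq : ∀ i, v i = -E.c i (x i) + ∑ j, recognition E r x j * u i j
  effort_optimal : ∀ i y,
    -E.c i (y : ℝ≥0) + ∑ j, recognition E r (Function.update x i y) j * u i j ≤ v i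
  v_nonneg : ∀ i, 0 ≤ v i
  sum_v_le : ∑ i, v i ≤ 1
  u_nonneg : ∀ i j, 0 ≤ u i j
  sum_u_le : ∀ j, ∑ i, u i j ≤ 1
  le_u_self : ∀ i, 1 - ∑ j ∈ Finset.univ.erase i, E.δ j * v j ≤ u i i
  u_self_of_k_eq_one : r.k = 1 → ∀ i, 1 ≤ u i i

/-! ### Monotone technologies and recognition probabilities -/

theorem f_strictMonoOn (hE : E.Regular) (i : Fin n) : StrictMonoOn (E.f i) (Set.Ici 0) := by
  refine strictMonoOn_of_deriv_pos (convex_Ici 0) (hE.f_cont i) fun x hx => ?_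
  rw [interior_Ici] at hx
  exact hE.f_deriv_pos i x hx

theorem c_strictMonoOn (hE : E.Regular) (i : Fin n) : StrictMonoOn (E.c i) (Set.Ici 0) := by
  refine strictMonoOn_of_deriv_pos (convex_Ici 0) (hE.c_cont i) fun x hx => ?_
  rw [interior_Ici] at hx
  exact hE.c_deriv_pos i x hx

theorem f_strictMono (hE : E.Regular) (i : Fin n) : StrictMono fun x : ℝ≥0 => E.f i x :=
  fun x y hxy => f_strictMonoOn hE i x.2 y.2 hxy

theorem c_strictMono (hE : E.Regular) (i : Fin n) : StrictMono fun x : ℝ≥0 => E.c i x :=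
  fun x y hxy => c_strictMonoOn hE i x.2 y.2 hxy

theorem f_nonneg (hE : E.Regular) (i : Fin n) (x : ℝ≥0) : 0 ≤ E.f i x := by
  have h := (f_strictMono hE i).monotone (zero_le (a := x))
  simpa [hE.f_zero i] using h

theorem c_nonneg (hE : E.Regular) (i : Fin n) (x : ℝ≥0) : 0 ≤ E.c i x := by
  have h := (c_strictMono hE i).monotone (zero_le (a := x))
  simpa [hE.c_zero i] using h

theorem impact_nonneg (hE : E.Regular) (r : Rule n) (i : Fin n) (x : ℝ≥0) :
    0 ≤ impact E r i x :=
  add_nonneg (mul_nonneg (r.α_nonneg i) (f_nonneg hE i x)) (r.β_nonneg i)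

theorem recognition_nonneg (hE : E.Regular) (r : Rule n) (x : Fin n → ℝ≥0) (i : Fin n) :
    0 ≤ recognition E r x i := by
  rw [recognition]
  split_ifs with h
  · exact div_nonneg (impact_nonneg hE r i _) h.le
  · positivity

theorem sum_recognition (hn : 2 ≤ n) (E : Environment n) (r : Rule n) (x : Fin n → ℝ≥0) :
    ∑ i, recognition E r x i = 1 := by
  simp only [recognition]
  split_ifs with h
  · rw [← Finset.sum_div, div_self h.ne']
  · have : (n : ℝ) ≠ 0 := by positivity
    simp [this]

/-! ### Necessary conditions from simple deviations -/

/-- The division that leaves `b j` to every agent `j ≠ i` and the rest to agent `i`. -/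
def residualDivision (b : Fin n → ℝ) (hb : ∀ j, 0 ≤ b j) (i : Fin n)
    (hs : ∑ j ∈ Finset.univ.erase i, b j ≤ 1) : Division n :=
  ⟨Function.update b i (1 - ∑ j ∈ Finset.univ.erase i, b j), by
    constructor
    · intro j
      by_cases hj : j = i
      · subst hj
        simpa using hs
      · simpa [Function.update_of_ne hj] using hb j
    · rw [← Finset.add_sum_erase _ _ (Finset.mem_univ i)]
      have : ∀ j ∈ Finset.univ.erase i, Function.update b i
          (1 - ∑ j ∈ Finset.univ.erase i, b j) j = b j := fun j hj =>
        Function.update_of_ne (Finset.ne_of_mem_erase hj) _ _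
      rw [Finset.sum_congr rfl this, Function.update_self]
      ring⟩

/-- The strategy that agrees with `τ` except that it always proposes `s`. -/
def Strategy.withProposal (τ : Strategy n) (s : Division n) : Strategy n :=
  { τ with propose := fun _ _ => Lottery.dirac s }

open Classical in
/-- The strategy that agrees with `τ` except for effort `y` in the initial period. -/
def Strategy.withInitialEffort (τ : Strategy n) (y : ℝ≥0) : Strategy n :=
  { τ with effort := fun h => if h = [] then y else τ.effort h }

/-- The deviation acts only at the empty history, which never recurs after a round has been
appended. -/
theorem value_withInitialEffort (σ : Profile n) (i : Fin n) (y : ℝ≥0) (T : ℕ) (h : History n)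
    (hh : h ≠ []) :
    value E r (Function.update σ i ((σ i).withInitialEffort y)) i T h = value E r σ i T h := by
  induction T generalizing h with
  | zero => rfl
  | succ T ih =>
    have he : ∀ m, (Function.update σ i ((σ i).withInitialEffort y) m).effort h =
        (σ m).effort h := by
      intro m
      by_cases hm : m = i
      · subst hm
        simp [Strategy.withInitialEffort, hh]
      · rw [Function.update_of_ne hm]
    simp only [value, he]
    congr 1
    refine Finset.sum_congr rfl fun j _ => ?_
    congr 1
    refine proposeStage_congr (fun m => ?_) (fun m => ?_) (fun R => ih _ (by simp)) i _ j
    all_goals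
      by_cases hm : m = i
      · subst hm
        simp [Strategy.withInitialEffort]
      · rw [Function.update_of_ne hm]

theorem value_nil_withInitialEffort {σ : Profile n} (hσ : ∀ i, (σ i).IsStationary)
    {x : Fin n → ℝ≥0} (hx : ∀ i h, (σ i).effort h = x i) (i : Fin n) (y : ℝ≥0) (T : ℕ) :
    value E r (Function.update σ i ((σ i).withInitialEffort y)) i (T + 1) [] = -E.c i y +
      ∑ j, recognition E r (Function.update x i y) j *
        stagePayoff E r σ i j (value E r σ i T []) := by
  have he : (fun m => (Function.update σ i ((σ i).withInitialEffort y) m).effort []) =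
      Function.update x i y := by
    funext m
    by_cases hm : m = i
    · subst hm
      simp [Strategy.withInitialEffort]
    · rw [Function.update_of_ne hm, Function.update_of_ne hm, hx]
  have hi : (Function.update σ i ((σ i).withInitialEffort y) i).effort [] = y := by
    simp [Strategy.withInitialEffort]
  simp only [value, he, hi]
  congr 1
  refine Finset.sum_congr rfl fun j _ => ?_
  congr 1
  rw [← proposeStage_eq_stagePayoff hσ (U := value E r σ i T) (h := [])
    (fun R => value_eq_value_nil hσ i T _) i (Function.update x i y) j]
  refine proposeStage_congr (fun m => ?_) (fun m => ?_)
    (fun R => value_withInitialEffort σ i y T _ (by simp)) i _ j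
  all_goals
    by_cases hm : m = i
    · subst hm
      simp [Strategy.withInitialEffort]
    · rw [Function.update_of_ne hm]

theorem division_nonneg (s : Division n) (i : Fin n) : 0 ≤ s.1 i := s.2.1 i

/-- Everything later uses of equilibrium is extracted here from two deviations: a different initial
effort, and a different proposal that is sure to be approved. Leaving every other agent exactly `δ j
* v j` wins unanimous approval, whatever `k` is. -/
theorem IsSSPE.exists_isStationaryPayoff (hn : 2 ≤ n) (hE : E.Regular)
    (hδ : ∀ i, 0 < E.δ i ∧ E.δ i < 1) {σ : Profile n} (h : IsSSPE E r σ) {x : Fin n → ℝ≥0}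
    (hx : ∀ i h, (σ i).effort h = x i) : ∃ u v, IsStationaryPayoff E r x u v := by
  obtain ⟨hσ, hsp, v, hv, hvote⟩ := h
  have hv' : ∀ i, Tendsto (fun T => value E r σ i T []) atTop (𝓝 (v i)) := hv
  have hu : ∀ i j, Tendsto (fun T => stagePayoff E r σ i j (value E r σ i T [])) atTop
      (𝓝 (stagePayoff E r σ i j (v i))) := fun i j => tendsto_stagePayoff σ i j (hv' i)
  have v_eq : ∀ i, v i = -E.c i (x i) +
      ∑ j, recognition E r x j * stagePayoff E r σ i j (v i) := by
    intro i
    refine tendsto_nhds_unique ((tendsto_add_atTop_iff_nat 1).2 (hv' i)) ?_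
    simp only [value_succ_of_stationary hσ hx]
    exact (tendsto_finsetSum _ fun j _ => (hu i j).const_mul _).const_add _
  have effort_optimal : ∀ i (y : ℝ≥0), -E.c i y +
      ∑ j, recognition E r (Function.update x i y) j * stagePayoff E r σ i j (v i) ≤ v i := by
    intro i y
    obtain ⟨w, hw, hopt⟩ := hsp (.start []) i
    rw [tendsto_nhds_unique (hv' i) hw]
    refine hopt ((σ i).withInitialEffort y) _ ((tendsto_add_atTop_iff_nat 1).1 ?_)
    simp only [nodeValue, value_nil_withInitialEffort hσ hx]
    rw [← tendsto_nhds_unique (hv' i) hw]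
    exact (tendsto_finsetSum _ fun j _ => (hu i j).const_mul _).const_add _
  have v_nonneg : ∀ i, 0 ≤ v i := by
    intro i
    -- If `v i < 0`, zero effort costs nothing and every proposal yields at least `δ i * v i > v i`,
    -- by a nonnegative share or by delay.
    by_contra! hneg
    have h0 := effort_optimal i 0
    have hge : ∀ j, E.δ i * v i ≤ stagePayoff E r σ i j (v i) := by
      intro j
      rw [← Lottery.expect_const ((σ j).propose [] 0) (E.δ i * v i)]
      refine Lottery.expect_mono _ fun s => ?_
      rw [voteStage]
      split_ifs
      · have := division_nonneg s i
        nlinarith [(hδ i).1]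
      · exact le_rfl
    have hsum : E.δ i * v i ≤ ∑ j, recognition E r (Function.update x i 0) j *
        stagePayoff E r σ i j (v i) := by
      calc E.δ i * v i = ∑ j, recognition E r (Function.update x i 0) j * (E.δ i * v i) := by
            rw [← Finset.sum_mul, sum_recognition hn, one_mul]
        _ ≤ _ := Finset.sum_le_sum fun j _ =>
            mul_le_mul_of_nonneg_left (hge j) (recognition_nonneg hE r _ j)
    simp only [NNReal.coe_zero, hE.c_zero i] at h0
    nlinarith [(hδ i).2]
  have sum_le : ∀ b : ℝ, 1 ≤ b → ∑ i, E.δ i * v i ≤ b →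
      ∀ j, ∑ i, stagePayoff E r σ i j (v i) ≤ b := by
    intro b hb hb' j
    simp only [stagePayoff, proposeStage]
    rw [Lottery.sum_expect, ← Lottery.expect_const ((σ j).propose [] 0) b]
    refine Lottery.expect_mono _ fun s => ?_
    simp only [voteStage]
    split_ifs
    · rw [s.2.2]
      exact hb
    · exact hb'
  have δv_le : ∀ i, E.δ i * v i ≤ v i := fun i => by nlinarith [v_nonneg i, (hδ i).2]
  have sum_v_le : ∑ i, v i ≤ 1 := by
    -- Total payoff is at most the larger of one dollar and the discounted total; above one,
    -- discounting makes this impossible.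
    by_contra! hgt
    have hlt : ∑ i, E.δ i * v i < ∑ i, v i := by
      refine Finset.sum_lt_sum (fun i _ => δv_le i) ?_
      obtain ⟨i, hi, hpos⟩ := Finset.exists_lt_of_sum_lt (s := Finset.univ) (f := fun _ => (0 : ℝ))
        (g := v) (by simpa using zero_lt_one.trans hgt)
      exact ⟨i, hi, by nlinarith [(hδ i).2]⟩
    have key : ∑ i, v i ≤ max 1 (∑ i, E.δ i * v i) := by
      calc ∑ i, v i ≤ ∑ i, ∑ j, recognition E r x j * stagePayoff E r σ i j (v i) := by
            refine Finset.sum_le_sum fun i _ => ?_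
            have := v_eq i
            have := c_nonneg hE i (x i)
            linarith
        _ = ∑ j, recognition E r x j * ∑ i, stagePayoff E r σ i j (v i) := by
            rw [Finset.sum_comm]
            simp only [Finset.mul_sum]
        _ ≤ ∑ j, recognition E r x j * max 1 (∑ i, E.δ i * v i) :=
            Finset.sum_le_sum fun j _ => mul_le_mul_of_nonneg_left
              (sum_le _ (le_max_left _ _) (le_max_right _ _) j) (recognition_nonneg hE r x j)
        _ = _ := by rw [← Finset.sum_mul, sum_recognition hn, one_mul]
    rcases le_max_iff.1 key with h1 | h1 <;> linarith
  -- The hypothesis of a payoff constant in `T` covers approved proposals, for which play after the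
  -- current period is irrelevant.
  have propose_optimal : ∀ i (s : Division n) (b : ℝ),
      (∀ T, voteStage E r (Function.update σ i ((σ i).withProposal s)) i
        (value E r (Function.update σ i ((σ i).withProposal s)) i T) [] 0 i s = b) →
      b ≤ stagePayoff E r σ i i (v i) := by
    intro i s b hb
    obtain ⟨w, hw, hopt⟩ := hsp (.propose [] 0 i) i
    have hw' : w = stagePayoff E r σ i i (v i) := by
      refine tendsto_nhds_unique hw ?_
      simp only [nodeValue]
      have : ∀ T, proposeStage E r σ i (value E r σ i T) [] 0 i =
          stagePayoff E r σ i i (value E r σ i T []) := fun T =>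
        proposeStage_eq_stagePayoff hσ (fun R => value_eq_value_nil hσ i T _) i 0 i
      simp only [this]
      exact hu i i
    rw [← hw']
    refine hopt ((σ i).withProposal s) b ?_
    have : ∀ T, nodeValue E r (Function.update σ i ((σ i).withProposal s)) i T
        (.propose [] 0 i) = b := by
      intro T
      rw [← hb T]
      simp only [nodeValue, proposeStage, Function.update_self]
      exact Lottery.expect_dirac _ _
    simp only [HasPayoff, this]
    exact tendsto_const_nhds
  refine ⟨fun i j => stagePayoff E r σ i j (v i), v, v_eq, effort_optimal, v_nonneg, sum_v_le,
    fun i j => ?_, fun j => ?_, fun i => ?_, fun hk i => ?_⟩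
  · rw [← Lottery.expect_const ((σ j).propose [] 0) 0]
    refine Lottery.expect_mono _ fun s => ?_
    rw [voteStage]
    split_ifs
    · exact division_nonneg s i
    · exact mul_nonneg (hδ i).1.le (v_nonneg i)
  · exact sum_le 1 le_rfl ((Finset.sum_le_sum fun i _ => δv_le i).trans sum_v_le) j
  · have hb : ∀ j, 0 ≤ E.δ j * v j := fun j => mul_nonneg (hδ j).1.le (v_nonneg j)
    have hs : ∑ j ∈ Finset.univ.erase i, E.δ j * v j ≤ 1 :=
      calc ∑ j ∈ Finset.univ.erase i, E.δ j * v j ≤ ∑ j, E.δ j * v j :=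
            Finset.sum_le_sum_of_subset_of_nonneg (Finset.erase_subset _ _) fun j _ _ => hb j
        _ ≤ 1 := (Finset.sum_le_sum fun i _ => δv_le i).trans sum_v_le
    refine propose_optimal i (residualDivision (fun j => E.δ j * v j) hb i hs) _ fun T => ?_
    rw [voteStage, if_pos]
    · simp [residualDivision]
    · have : favor (Function.update σ i ((σ i).withProposal
          (residualDivision (fun j => E.δ j * v j) hb i hs))) [] 0 i
          (residualDivision (fun j => E.δ j * v j) hb i hs) = Finset.univ := by
        refine Finset.eq_univ_of_forall fun m => ?_
        by_cases hm : m = i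
        · rw [hm]
          exact proposer_mem_favor _ _ _ _ _
        · simp only [favor, Finset.mem_filter, Finset.mem_univ, true_and, Function.update_of_ne hm]
          right
          rw [hvote m _ _ _ _ (Ne.symm hm)]
          simp [residualDivision, Function.update_of_ne hm]
      rw [this, Finset.card_univ, Fintype.card_fin]
      exact r.k_le
  -- With `k = 1`, offering zero to everyone else keeps the whole dollar.
  · refine propose_optimal i (residualDivision 0 (fun _ => le_rfl) i (by simp)) 1 fun T => ?_
    rw [voteStage_of_k_eq_one hk]
    simp [residualDivision]

end

section


variable {n : ℕ} {E : Environment n} {r : Rule n}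

/-! ### Contests -/

theorem f_concaveOn (hE : E.Regular) (i : Fin n) : ConcaveOn ℝ (Set.Ici 0) (E.f i) := by
  refine concaveOn_of_deriv2_nonpos (convex_Ici 0) (hE.f_cont i) ?_ ?_ ?_
  · rw [interior_Ici]
    exact hE.f_diff i
  · rw [interior_Ici]
    exact hE.f_diff₂ i
  · rw [interior_Ici]
    exact hE.f_deriv₂_nonpos i

theorem c_convexOn (hE : E.Regular) (i : Fin n) : ConvexOn ℝ (Set.Ici 0) (E.c i) := by
  refine convexOn_of_deriv2_nonneg (convex_Ici 0) (hE.c_cont i) ?_ ?_ ?_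
  · rw [interior_Ici]
    exact hE.c_diff i
  · rw [interior_Ici]
    exact hE.c_diff₂ i
  · rw [interior_Ici]
    exact hE.c_deriv₂_nonneg i

/-- The sum of all impacts. -/
def totalImpact (E : Environment n) (r : Rule n) (x : Fin n → ℝ≥0) : ℝ :=
  ∑ j, impact E r j (x j)

theorem totalImpact_nonneg (hE : E.Regular) (r : Rule n) (x : Fin n → ℝ≥0) :
    0 ≤ totalImpact E r x :=
  Finset.sum_nonneg fun j _ => impact_nonneg hE r j (x j)

theorem recognition_of_pos {x : Fin n → ℝ≥0} (h : 0 < totalImpact E r x) (i : Fin n) :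
    recognition E r x i = impact E r i (x i) / totalImpact E r x :=
  if_pos h

theorem recognition_of_not_pos {x : Fin n → ℝ≥0} (h : ¬ 0 < totalImpact E r x) (i : Fin n) :
    recognition E r x i = 1 / (n : ℝ) :=
  if_neg h

theorem recognition_le_one (hn : 2 ≤ n) (hE : E.Regular) (r : Rule n) (x : Fin n → ℝ≥0)
    (i : Fin n) : recognition E r x i ≤ 1 := by
  rw [← sum_recognition hn E r x]
  exact Finset.single_le_sum (fun j _ => recognition_nonneg hE r x j) (Finset.mem_univ i)

theorem impact_update_of_ne {i j : Fin n} (h : j ≠ i) (x : Fin n → ℝ≥0) (y : ℝ≥0) :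
    impact E r j (Function.update x i y j) = impact E r j (x j) := by
  rw [Function.update_of_ne h]

theorem sum_erase_impact (x : Fin n → ℝ≥0) (i : Fin n) :
    ∑ j ∈ Finset.univ.erase i, impact E r j (x j) = totalImpact E r x - impact E r i (x i) := by
  rw [totalImpact, ← Finset.add_sum_erase _ _ (Finset.mem_univ i)]
  ring

theorem totalImpact_update (x : Fin n → ℝ≥0) (i : Fin n) (y : ℝ≥0) :
    totalImpact E r (Function.update x i y) =
      totalImpact E r x - impact E r i (x i) + impact E r i y := by
  have h : ∑ j ∈ Finset.univ.erase i, impact E r j (Function.update x i y j) =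
      ∑ j ∈ Finset.univ.erase i, impact E r j (x j) :=
    Finset.sum_congr rfl fun j hj => impact_update_of_ne (Finset.ne_of_mem_erase hj) x y
  rw [sum_erase_impact, sum_erase_impact, Function.update_self] at h
  linarith

theorem impact_sub_impact (i : Fin n) (x y : ℝ≥0) :
    impact E r i y - impact E r i x = r.α i * (E.f i y - E.f i x) := by
  simp only [impact]
  ring

theorem totalImpact_update_eq_add (x : Fin n → ℝ≥0) (i : Fin n) (y : ℝ≥0) :
    totalImpact E r (Function.update x i y) =
      totalImpact E r x + r.α i * (E.f i y - E.f i (x i)) := by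
  rw [totalImpact_update, ← impact_sub_impact]
  ring

theorem impact_le_totalImpact (hE : E.Regular) (x : Fin n → ℝ≥0) (i : Fin n) :
    impact E r i (x i) ≤ totalImpact E r x :=
  Finset.single_le_sum (f := fun j => impact E r j (x j)) (fun j _ => impact_nonneg hE r j (x j))
    (Finset.mem_univ i)

theorem recognition_update_eq {x : Fin n → ℝ≥0} {i : Fin n} {y : ℝ≥0}
    (h : impact E r i y = impact E r i (x i)) :
    recognition E r (Function.update x i y) = recognition E r x := by
  have hj : ∀ j, impact E r j (Function.update x i y j) = impact E r j (x j) := by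
    intro j
    by_cases hji : j = i
    · subst hji
      simpa using h
    · exact impact_update_of_ne hji x y
  funext j
  simp only [recognition, hj]

/-- The first-order conditions for an equilibrium of the contest for a prize of one dollar,
written without derivatives. -/
def IsContestEq (E : Environment n) (r : Rule n) (x : Fin n → ℝ≥0) : Prop :=
  0 < totalImpact E r x ∧ ∀ i (y : ℝ≥0),
    r.α i * (1 - recognition E r x i) / totalImpact E r x * (E.f i y - E.f i (x i)) ≤
      E.c i y - E.c i (x i)

theorem eq_zero_of_cost_nonpos (hE : E.Regular) {i : Fin n} {x : ℝ≥0} (h : E.c i x ≤ 0) :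
    x = 0 := by
  by_contra hx
  have := c_strictMono hE i (pos_iff_ne_zero.2 hx)
  simp only [NNReal.coe_zero, hE.c_zero i] at this
  linarith

/-- Linearization of a best response: if the gain from every deviation is at most its cost, then so
is its first-order approximation. -/
theorem linearized_of_optimal (hE : E.Regular) {i : Fin n} {x : ℝ≥0} {G S a : ℝ} (hG : 0 ≤ G)
    (hS : 0 < S) (h : ∀ y : ℝ≥0, 0 < S + a * (E.f i y - E.f i x) →
      G * (E.f i y - E.f i x) / (S * (S + a * (E.f i y - E.f i x))) ≤ E.c i y - E.c i x)
    (y : ℝ≥0) : G / S ^ 2 * (E.f i y - E.f i x) ≤ E.c i y - E.c i x := by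
  -- Deviate to a point at fraction `t` of the way from `x` to `y`: concavity of `f` and convexity
  -- of `c` bound gain and cost by `t` times the full differences. Divide by `t` and let `t` tend to
  -- `0`; no derivative is needed, so `x = 0` is no special case.
  let z : ℝ → ℝ := fun t => (1 - t) * x + t * y
  have hz : ContinuousWithinAt (fun t => E.f i (z t)) (Set.Icc 0 1) 0 := by
    refine ContinuousWithinAt.comp (t := Set.Ici 0) (hE.f_cont i (z 0) ?_) (by fun_prop) ?_
    · simp [z]
    · intro t ht
      have h0 := ht.1
      have h1 := sub_nonneg.2 ht.2
      simp only [z, Set.mem_Ici]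
      positivity
  have hz0 : z 0 = x := by simp [z]
  have hD : Tendsto (fun t => S + a * (E.f i (z t) - E.f i x)) (𝓝[>] 0) (𝓝 S) := by
    have h1 : Tendsto (fun t => E.f i (z t)) (𝓝[>] 0) (𝓝 (E.f i x)) := by
      have h2 : Tendsto (fun t => E.f i (z t)) (𝓝[Set.Icc 0 1] 0) (𝓝 (E.f i (z 0))) := hz
      rw [hz0] at h2
      refine h2.mono_left ?_
      rw [← nhdsWithin_Ioc_eq_nhdsGT (zero_lt_one' ℝ)]
      exact nhdsWithin_mono _ Set.Ioc_subset_Icc_self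
    have h3 := ((h1.sub_const (E.f i x)).const_mul a).const_add S
    simpa using h3
  have hkey : G * (E.f i y - E.f i x) ≤ (E.c i y - E.c i x) * (S * S) := by
    refine ge_of_tendsto ((hD.const_mul S).const_mul (E.c i y - E.c i x)) ?_
    filter_upwards [hD.eventually (lt_mem_nhds hS), Ioc_mem_nhdsGT (zero_lt_one' ℝ)] with t hDt ht
    have ht1 : 0 ≤ 1 - t := sub_nonneg.2 ht.2
    have hzt : 0 ≤ z t := by
      have := ht.1
      simp only [z]
      positivity
    have hdev := h ⟨z t, hzt⟩ hDt
    change G * (E.f i (z t) - E.f i x) / (S * (S + a * (E.f i (z t) - E.f i x))) ≤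
      E.c i (z t) - E.c i x at hdev
    rw [div_le_iff₀ (mul_pos hS hDt)] at hdev
    have hf : (1 - t) * E.f i x + t * E.f i y ≤ E.f i (z t) :=
      (f_concaveOn hE i).2 x.2 y.2 ht1 ht.1.le (by ring)
    have hc : E.c i (z t) ≤ (1 - t) * E.c i x + t * E.c i y :=
      (c_convexOn hE i).2 x.2 y.2 ht1 ht.1.le (by ring)
    refine le_of_mul_le_mul_left ?_ ht.1
    calc t * (G * (E.f i y - E.f i x)) = G * ((1 - t) * E.f i x + t * E.f i y - E.f i x) := by ring
      _ ≤ G * (E.f i (z t) - E.f i x) := by gcongr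
      _ ≤ (E.c i (z t) - E.c i x) * (S * (S + a * (E.f i (z t) - E.f i x))) := hdev
      _ ≤ ((1 - t) * E.c i x + t * E.c i y - E.c i x) *
          (S * (S + a * (E.f i (z t) - E.f i x))) := by gcongr
      _ = _ := by ring
  rw [div_mul_eq_mul_div, div_le_iff₀ (by positivity)]
  linarith [hkey, sq S]

/-! ### Equilibrium efforts under an arbitrary rule -/

variable {x : Fin n → ℝ≥0} {u : Fin n → Fin n → ℝ} {v : Fin n → ℝ}

/-- Effort above a level giving the same recognition probabilities is pure waste, since `c` is
strictly increasing. -/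
theorem IsStationaryPayoff.effort_le (hE : E.Regular) (h : IsStationaryPayoff E r x u v)
    {i : Fin n} {y : ℝ≥0}
    (hy : recognition E r (Function.update x i y) = recognition E r x) : x i ≤ y := by
  have h1 := h.effort_optimal i y
  rw [hy, h.v_eq i] at h1
  by_contra! hlt
  have := c_strictMono hE i hlt
  simp only at this
  linarith

theorem IsStationaryPayoff.effort_eq_zero_of_impact_eq_zero (hE : E.Regular)
    (h : IsStationaryPayoff E r x u v) {i : Fin n} (hi : impact E r i (x i) = 0) : x i = 0 := by
  refine le_antisymm (h.effort_le hE (recognition_update_eq ?_)) zero_le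
  have hf := mul_nonneg (r.α_nonneg i) (f_nonneg hE i (x i))
  have hβ := r.β_nonneg i
  rw [hi]
  simp only [impact, NNReal.coe_zero, hE.f_zero i] at hi ⊢
  linarith

/-- If being proposer were no better than the equilibrium payoff, `le_u_self` and `∑ v ≤ 1` would
force `v j = 0` for all `j ≠ i`, because `δ j < 1`. But some `j ≠ i` is recognized with positive
probability, then keeps at least `1 - δ i * v i > 0`, and pays no effort cost, so `v j > 0`. -/
theorem IsStationaryPayoff.payoff_lt_of_effort_eq_zero (hn : 2 ≤ n) (hE : E.Regular)
    (hδ : ∀ i, 0 < E.δ i ∧ E.δ i < 1) (h : IsStationaryPayoff E r x u v) (hx : x = 0) {i : Fin n}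
    (hi : recognition E r x i < 1) : v i < u i i := by
  by_contra! hle
  have hself := h.le_u_self i
  have hsum := h.sum_v_le
  rw [← Finset.add_sum_erase _ _ (Finset.mem_univ i)] at hsum
  have hnn : ∀ j ∈ Finset.univ.erase i, 0 ≤ v j - E.δ j * v j := fun j _ => by
    nlinarith [h.v_nonneg j, (hδ j).2]
  have h0 : ∑ j ∈ Finset.univ.erase i, (v j - E.δ j * v j) = 0 := by
    refine le_antisymm ?_ (Finset.sum_nonneg hnn)
    rw [Finset.sum_sub_distrib]
    linarith
  have hv0 : ∀ j, j ≠ i → v j = 0 := by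
    intro j hj
    have := (Finset.sum_eq_zero_iff_of_nonneg hnn).1 h0 j (by simp [hj])
    have h1 : (1 - E.δ j) * v j = 0 := by linarith
    rcases mul_eq_zero.1 h1 with h2 | h2
    · linarith [(hδ j).2]
    · exact h2
  have hvi : v i ≤ 1 := by
    rw [Finset.sum_eq_zero fun j hj => hv0 j (Finset.ne_of_mem_erase hj)] at hsum
    linarith
  obtain ⟨j, hj, hpj⟩ : ∃ j, j ≠ i ∧ 0 < recognition E r x j := by
    by_contra! hcon
    have hone := sum_recognition hn E r x
    rw [← Finset.add_sum_erase _ _ (Finset.mem_univ i)] at hone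
    have : ∑ j ∈ Finset.univ.erase i, recognition E r x j ≤ 0 :=
      Finset.sum_nonpos fun j hj => hcon j (Finset.ne_of_mem_erase hj)
    linarith
  have hujj : 0 < u j j := by
    have h1 := h.le_u_self j
    have h2 : ∑ m ∈ Finset.univ.erase j, E.δ m * v m = E.δ i * v i := by
      refine Finset.sum_eq_single_of_mem i (by simp [hj.symm]) fun m _ hm => ?_
      rw [hv0 m hm, mul_zero]
    rw [h2] at h1
    nlinarith [(hδ i).1, (hδ i).2]
  have hvj := h.v_eq j
  rw [hv0 j hj, hx] at hvj
  simp only [Pi.zero_apply, NNReal.coe_zero, hE.c_zero j, neg_zero, zero_add] at hvj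
  rw [← hx] at hvj
  have : recognition E r x j * u j j ≤ ∑ m, recognition E r x m * u j m :=
    Finset.single_le_sum (f := fun m => recognition E r x m * u j m)
      (fun m _ => mul_nonneg (recognition_nonneg hE r x m) (h.u_nonneg j m)) (Finset.mem_univ j)
  nlinarith [mul_pos hpj hujj]

/-- At zero total impact all efforts vanish, and an agent with `α i > 0` becomes certain proposer by
an arbitrarily small effort. His gain `u i i - v i > 0` does not shrink while the cost does. -/
theorem IsStationaryPayoff.totalImpact_pos (hn : 2 ≤ n) (hE : E.Regular)
    (hδ : ∀ i, 0 < E.δ i ∧ E.δ i < 1) (h : IsStationaryPayoff E r x u v) :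
    0 < totalImpact E r x := by
  by_contra hneg
  have hS : totalImpact E r x = 0 := le_antisymm (not_lt.1 hneg) (totalImpact_nonneg hE r x)
  have ha : ∀ j, impact E r j (x j) = 0 := fun j =>
    le_antisymm (hS ▸ impact_le_totalImpact hE x j) (impact_nonneg hE r j _)
  have hx : x = 0 := funext fun j => h.effort_eq_zero_of_impact_eq_zero hE (ha j)
  obtain ⟨i, hi⟩ := Function.ne_iff.1 r.α_ne_zero
  have hαi : 0 < r.α i := lt_of_le_of_ne (r.α_nonneg i) (Ne.symm hi)
  have hlt := h.payoff_lt_of_effort_eq_zero hn hE hδ hx (i := i) (by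
    rw [recognition_of_not_pos hneg, div_lt_one (by positivity)]
    exact_mod_cast hn)
  have hgain : ∀ y : ℝ, 0 < y → u i i - v i ≤ E.c i y := by
    intro y hy
    lift y to ℝ≥0 using hy.le
    have hy' : 0 < y := hy
    have hf : 0 < E.f i y := by
      have := f_strictMono hE i hy'
      simpa [hE.f_zero i] using this
    have hT : totalImpact E r (Function.update x i y) = impact E r i y := by
      rw [totalImpact_update, hS, ha i]
      ring
    have hpos : 0 < impact E r i y :=
      add_pos_of_pos_of_nonneg (mul_pos hαi hf) (r.β_nonneg i)
    have hrec : ∑ j, recognition E r (Function.update x i y) j * u i j = u i i := by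
      rw [Finset.sum_eq_single_of_mem i (Finset.mem_univ i)]
      · rw [recognition_of_pos (hT ▸ hpos), hT, Function.update_self, div_self hpos.ne', one_mul]
      · intro j _ hj
        rw [recognition_of_pos (hT ▸ hpos), impact_update_of_ne hj, ha j, zero_div, zero_mul]
    have := h.effort_optimal i y
    rw [hrec] at this
    linarith
  have hc : Tendsto (E.c i) (𝓝[>] 0) (𝓝 0) := by
    have h1 : Tendsto (E.c i) (𝓝[≥] 0) (𝓝 (E.c i 0)) := hE.c_cont i 0 Set.self_mem_Ici
    rw [hE.c_zero i] at h1
    exact h1.mono_left (nhdsWithin_mono _ Set.Ioi_subset_Ici_self)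
  have := ge_of_tendsto hc (eventually_mem_nhdsWithin.mono fun y hy => hgain y hy)
  linarith

/-- The others have zero impact, hence zero effort; the certain proposer could halve a positive
effort and remain certain. -/
theorem IsStationaryPayoff.effort_eq_zero_of_recognition_eq_one (hn : 2 ≤ n) (hE : E.Regular)
    (hδ : ∀ i, 0 < E.δ i ∧ E.δ i < 1) (h : IsStationaryPayoff E r x u v) {i : Fin n}
    (hi : recognition E r x i = 1) : x = 0 := by
  have hS := h.totalImpact_pos hn hE hδ
  rw [recognition_of_pos hS, div_eq_one_iff_eq hS.ne'] at hi
  have ha : ∀ j, j ≠ i → impact E r j (x j) = 0 := by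
    have h1 := sum_erase_impact (E := E) (r := r) x i
    rw [hi, sub_self, Finset.sum_eq_zero_iff_of_nonneg fun j _ => impact_nonneg hE r j _] at h1
    exact fun j hj => h1 j (by simp [hj])
  funext j
  by_cases hj : j = i
  · subst hj
    by_contra hne
    have hxj : 0 < x j := pos_iff_ne_zero.2 hne
    have hy : 0 < impact E r j (x j / 2) := by
      have hf : 0 < E.f j (x j / 2 : ℝ≥0) := by
        have := f_strictMono hE j (half_pos hxj)
        simpa [hE.f_zero j] using this
      rcases (r.β_nonneg j).eq_or_lt with hβ | hβ
      · rcases (r.α_nonneg j).eq_or_lt with hα | hα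
        · simp only [impact, ← hα, ← hβ] at hi
          linarith
        · exact add_pos_of_pos_of_nonneg (mul_pos hα hf) (r.β_nonneg j)
      · exact add_pos_of_nonneg_of_pos (mul_nonneg (r.α_nonneg j) hf.le) hβ
    have hT : totalImpact E r (Function.update x j (x j / 2)) = impact E r j (x j / 2) := by
      rw [totalImpact_update, hi]
      ring
    have hle := h.effort_le hE (i := j) (y := x j / 2) (by
      funext m
      rw [recognition_of_pos hS, recognition_of_pos (hT ▸ hy), hT]
      by_cases hm : m = j
      · subst hm
        rw [Function.update_self, div_self hy.ne', hi, div_self hS.ne']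
      · rw [impact_update_of_ne hm, ha m hm, zero_div, zero_div])
    exact absurd hle (not_le.2 (half_lt_self hxj))
  · exact h.effort_eq_zero_of_impact_eq_zero hE (ha j hj)

/-- The difference between the payoff of agent `i` as a proposer and his expected payoff conditional
on not being recognized. -/
def prize (E : Environment n) (r : Rule n) (x : Fin n → ℝ≥0) (u : Fin n → Fin n → ℝ) (i : Fin n) :
    ℝ :=
  u i i - (∑ j ∈ Finset.univ.erase i, impact E r j (x j) * u i j) /
    (totalImpact E r x - impact E r i (x i))

theorem sum_recognition_mul {z : Fin n → ℝ≥0} (hz : 0 < totalImpact E r z) (w : Fin n → ℝ)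
    (i : Fin n) : ∑ j, recognition E r z j * w j =
      (impact E r i (z i) * w i + ∑ j ∈ Finset.univ.erase i, impact E r j (z j) * w j) /
        totalImpact E r z := by
  rw [Finset.add_sum_erase _ (fun j => impact E r j (z j) * w j) (Finset.mem_univ i),
    Finset.sum_div]
  exact Finset.sum_congr rfl fun j _ => by rw [recognition_of_pos hz, div_mul_eq_mul_div]

/-- The others' impacts are fixed, so the payoff change is the prize times the change in agent `i`'s
own recognition probability, in the form required by `linearized_of_optimal`. -/
theorem sum_recognition_update_sub (hS : 0 < totalImpact E r x) {i : Fin n} {y : ℝ≥0}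
    (hA : impact E r i (x i) < totalImpact E r x)
    (hy : 0 < totalImpact E r (Function.update x i y)) :
    ∑ j, recognition E r (Function.update x i y) j * u i j - ∑ j, recognition E r x j * u i j =
      prize E r x u i * (r.α i * (totalImpact E r x - impact E r i (x i))) *
        (E.f i y - E.f i (x i)) /
        (totalImpact E r x * (totalImpact E r x + r.α i * (E.f i y - E.f i (x i)))) := by
  have hB : ∑ j ∈ Finset.univ.erase i, impact E r j (Function.update x i y j) * u i j =
      ∑ j ∈ Finset.univ.erase i, impact E r j (x j) * u i j :=
    Finset.sum_congr rfl fun j hj => by rw [impact_update_of_ne (Finset.ne_of_mem_erase hj)]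
  have hT := totalImpact_update_eq_add (E := E) (r := r) x i y
  have hI : impact E r i y = impact E r i (x i) + r.α i * (E.f i y - E.f i (x i)) := by
    rw [← impact_sub_impact]
    ring
  rw [sum_recognition_mul hy _ i, sum_recognition_mul hS _ i, hB, Function.update_self, prize]
  rw [hT] at hy ⊢
  rw [hI]
  have hA' : totalImpact E r x - impact E r i (x i) ≠ 0 := (sub_pos.2 hA).ne'
  have hy' := hy.ne'
  have hS' := hS.ne'
  generalize totalImpact E r x = S at *
  generalize impact E r i (x i) = a at *
  generalize E.f i y - E.f i (x i) = d at *
  generalize ∑ j ∈ Finset.univ.erase i, impact E r j (x j) * u i j = B at *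
  field_simp
  ring

theorem IsStationaryPayoff.prize_le_one (hE : E.Regular) (h : IsStationaryPayoff E r x u v)
    (i : Fin n) : prize E r x u i ≤ 1 := by
  have h1 : u i i ≤ 1 := (Finset.single_le_sum (f := fun j => u j i)
    (fun j _ => h.u_nonneg j i) (Finset.mem_univ i)).trans (h.sum_u_le i)
  have h2 : 0 ≤ (∑ j ∈ Finset.univ.erase i, impact E r j (x j) * u i j) /
      (totalImpact E r x - impact E r i (x i)) :=
    div_nonneg (Finset.sum_nonneg fun j _ => mul_nonneg (impact_nonneg hE r j _) (h.u_nonneg i j))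
      (sub_nonneg.2 (impact_le_totalImpact hE x i))
  rw [prize]
  linarith

/-- Equilibrium efforts satisfy the first-order conditions of a contest in which agent `i` competes
for the positive part of `prize E r x u i`. -/
theorem IsStationaryPayoff.linearized (hE : E.Regular) (h : IsStationaryPayoff E r x u v)
    (hS : 0 < totalImpact E r x) {i : Fin n} (hi : recognition E r x i < 1) (y : ℝ≥0) :
    max (prize E r x u i) 0 * r.α i * (1 - recognition E r x i) / totalImpact E r x *
      (E.f i y - E.f i (x i)) ≤ E.c i y - E.c i (x i) := by
  have hA : impact E r i (x i) < totalImpact E r x := by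
    rwa [recognition_of_pos hS, div_lt_one hS] at hi
  have hTpos : ∀ y, 0 < totalImpact E r (Function.update x i y) := fun y => by
    rw [totalImpact_update]
    linarith [impact_nonneg hE r i y]
  have hgain : ∀ y : ℝ≥0, prize E r x u i * (r.α i * (totalImpact E r x - impact E r i (x i))) *
      (E.f i y - E.f i (x i)) /
      (totalImpact E r x * (totalImpact E r x + r.α i * (E.f i y - E.f i (x i)))) ≤
      E.c i y - E.c i (x i) := by
    intro y
    rw [← sum_recognition_update_sub hS hA (hTpos y)]
    have h1 := h.effort_optimal i y
    have h2 := h.v_eq i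
    linarith
  rcases le_total (prize E r x u i) 0 with hW | hW
  -- With a nonpositive prize, dropping to zero effort does not reduce the expected stage payoff, so
  -- any positive cost is wasted.
  · have hx : x i = 0 := by
      refine eq_zero_of_cost_nonpos hE (i := i) ?_
      have h0 := hgain 0
      have hpos := hTpos 0
      rw [totalImpact_update_eq_add] at hpos
      simp only [NNReal.coe_zero, hE.c_zero i, hE.f_zero i] at h0 hpos
      have h1 : 0 ≤ prize E r x u i * (r.α i * (totalImpact E r x - impact E r i (x i))) *
          (0 - E.f i (x i)) / (totalImpact E r x *
            (totalImpact E r x + r.α i * (0 - E.f i (x i)))) := by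
        refine div_nonneg (mul_nonneg_of_nonpos_of_nonpos ?_ ?_) (mul_pos hS hpos).le
        · exact mul_nonpos_of_nonpos_of_nonneg hW
            (mul_nonneg (r.α_nonneg i) (sub_pos.2 hA).le)
        · linarith [f_nonneg hE i (x i)]
      linarith
    rw [max_eq_right hW, hx]
    simp only [NNReal.coe_zero, hE.c_zero i, zero_mul, zero_div, sub_zero]
    exact c_nonneg hE i y
  · rw [max_eq_left hW]
    have := linearized_of_optimal hE (G := prize E r x u i *
      (r.α i * (totalImpact E r x - impact E r i (x i))))
      (mul_nonneg hW (mul_nonneg (r.α_nonneg i) (sub_pos.2 hA).le)) hS (fun y _ => hgain y) y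
    refine le_of_eq_of_le ?_ this
    rw [recognition_of_pos hS]
    have hS' := hS.ne'
    field_simp

end

section


variable {n : ℕ} {E : Environment n} {r : Rule n} {x : Fin n → ℝ≥0}

/-! ### Rules under which the proposer needs no approval -/

theorem eq_zero_of_forall_cost_le (hE : E.Regular) {i : Fin n} {z : ℝ≥0}
    (h : ∀ y : ℝ≥0, 0 ≤ E.c i y - E.c i z) : z = 0 := by
  refine eq_zero_of_cost_nonpos hE (i := i) ?_
  have := h 0
  rw [NNReal.coe_zero, hE.c_zero i] at this
  linarith

/-- The recognition probability is concave in own impact, so the linear condition is also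
sufficient: `key` shows that the linearization exceeds it by a nonnegative quadratic remainder. -/
theorem IsContestEq.best_response (hn : 2 ≤ n) (hE : E.Regular) (h : IsContestEq E r x) (i : Fin n)
    (y : ℝ≥0) : recognition E r (Function.update x i y) i - E.c i y ≤
      recognition E r x i - E.c i (x i) := by
  obtain ⟨hS, hopt⟩ := h
  have hA : 0 ≤ totalImpact E r x - impact E r i (x i) :=
    sub_nonneg.2 (impact_le_totalImpact hE x i)
  by_cases hy : 0 < totalImpact E r (Function.update x i y)
  · have hI : impact E r i y = impact E r i (x i) + r.α i * (E.f i y - E.f i (x i)) := by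
      rw [← impact_sub_impact]
      ring
    have hcost := hopt i y
    rw [recognition_of_pos hy, Function.update_self, hI, totalImpact_update_eq_add]
    rw [totalImpact_update_eq_add] at hy
    rw [recognition_of_pos hS] at hcost ⊢
    have hS' := hS.ne'
    have hy' := hy.ne'
    generalize totalImpact E r x = S at *
    generalize impact E r i (x i) = a at *
    generalize E.f i y - E.f i (x i) = d at *
    have key : a / S + r.α i * (1 - a / S) / S * d - (a + r.α i * d) / (S + r.α i * d) =
        (r.α i * d) ^ 2 * (S - a) / (S ^ 2 * (S + r.α i * d)) := by
      field_simp
      ring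
    have hnn : 0 ≤ (r.α i * d) ^ 2 * (S - a) / (S ^ 2 * (S + r.α i * d)) := by positivity
    linarith
  -- Total impact can vanish after the deviation only if all other impacts are zero, so agent `i`
  -- was already certain to be recognized.
  · have hA0 : impact E r i (x i) = totalImpact E r x := by
      rw [totalImpact_update] at hy
      linarith [impact_nonneg hE r i y]
    have hone : recognition E r x i = 1 := by
      rw [recognition_of_pos hS, hA0, div_self hS.ne']
    have hcost := hopt i y
    rw [hone, sub_self, mul_zero, zero_div, zero_mul] at hcost
    rw [hone]
    linarith [recognition_le_one hn hE r (Function.update x i y) i]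

/-- The division that gives the whole dollar to agent `i`. -/
def wholeDollar (i : Fin n) : Division n := ⟨Pi.single i 1, single_mem_stdSimplex ℝ i⟩

open Classical in
/-- The profile in which agent `i` exerts effort `x i`, demands the whole dollar and accepts shares
of at least `b i`. -/
def demandAll (x : Fin n → ℝ≥0) (b : Fin n → ℝ) : Profile n := fun i =>
  { effort := fun _ => x i
    propose := fun _ _ => Lottery.dirac (wholeDollar i)
    vote := fun _ _ _ s => decide (b i ≤ s.1 i) }

/-- With `k = 1` the game ends in its first period, and a deviator facing opponents who demand
everything receives something, at most one dollar, only as proposer. -/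
theorem value_succ_le_of_deviation (hk : r.k = 1) (hE : E.Regular) (b : Fin n → ℝ) (i : Fin n)
    (τ : Strategy n) (T : ℕ) (h : History n) :
    value E r (Function.update (demandAll x b) i τ) i (T + 1) h ≤
      recognition E r (Function.update x i (τ.effort h)) i - E.c i (τ.effort h) := by
  have he : (fun m => (Function.update (demandAll x b) i τ m).effort h) =
      Function.update x i (τ.effort h) := by
    funext m
    by_cases hm : m = i
    · subst hm
      simp
    · simp [Function.update_of_ne hm, demandAll]
  simp only [value, he, Function.update_self, proposeStage_of_k_eq_one hk]
  have hsum : ∑ j, recognition E r (Function.update x i (τ.effort h)) j *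
      ((Function.update (demandAll x b) i τ j).propose h
        (Function.update x i (τ.effort h))).expect (fun s => s.1 i) ≤
      recognition E r (Function.update x i (τ.effort h)) i := by
    rw [← Finset.add_sum_erase _ _ (Finset.mem_univ i), Finset.sum_eq_zero, add_zero]
    · refine mul_le_of_le_one_right (recognition_nonneg hE r _ i) ?_
      rw [← Lottery.expect_const ((Function.update (demandAll x b) i τ i).propose h
        (Function.update x i (τ.effort h))) 1]
      refine Lottery.expect_mono _ fun s => ?_
      rw [← s.2.2]
      exact Finset.single_le_sum (fun j _ => division_nonneg s j) (Finset.mem_univ i)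
    · intro j hj
      have hji := Finset.ne_of_mem_erase hj
      simp [Function.update_of_ne hji, demandAll, Lottery.expect_dirac, wholeDollar, hji.symm]
  linarith

theorem value_demandAll (hk : r.k = 1) (b : Fin n → ℝ) (i : Fin n) (T : ℕ) (h : History n) :
    value E r (demandAll x b) i (T + 1) h = recognition E r x i - E.c i (x i) := by
  simp only [value, proposeStage_of_k_eq_one hk, demandAll, Lottery.expect_dirac, wholeDollar]
  rw [Finset.sum_eq_single_of_mem i (Finset.mem_univ i)]
  · simp
    ring
  · intro j _ hj
    simp [hj.symm]

theorem hasPayoff_start_demandAll (hk : r.k = 1) (b : Fin n → ℝ) (i : Fin n) (h : History n) :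
    HasPayoff E r (demandAll x b) i (.start h) (recognition E r x i - E.c i (x i)) := by
  refine (tendsto_add_atTop_iff_nat 1).1 ?_
  simp only [nodeValue, value_demandAll hk]
  exact tendsto_const_nhds

theorem isSubgamePerfect_demandAll (hn : 2 ≤ n) (hE : E.Regular) (hk : r.k = 1)
    (h : IsContestEq E r x) (b : Fin n → ℝ) : IsSubgamePerfect E r (demandAll x b) := by
  rintro (h' | ⟨h', z, j⟩ | ⟨h', z, j, s⟩) i
  · refine ⟨_, hasPayoff_start_demandAll hk b i h', fun τ u' hu' => ?_⟩
    refine le_of_tendsto' ((tendsto_add_atTop_iff_nat 1).2 hu') fun T => ?_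
    exact (value_succ_le_of_deviation hk hE b i τ T h').trans (h.best_response hn hE i _)
  · refine ⟨(wholeDollar j).1 i, ?_, fun τ u' hu' => ?_⟩
    · simp only [HasPayoff, nodeValue, proposeStage_of_k_eq_one hk, demandAll,
        Lottery.expect_dirac]
      exact tendsto_const_nhds
    · simp only [HasPayoff, nodeValue, proposeStage_of_k_eq_one hk] at hu'
      rw [← tendsto_nhds_unique tendsto_const_nhds hu']
      by_cases hj : j = i
      · subst hj
        rw [← Lottery.expect_const ((Function.update (demandAll x b) j τ j).propose h' z)
          ((wholeDollar j).1 j)]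
        refine Lottery.expect_mono _ fun s => ?_
        simp only [wholeDollar, Pi.single_eq_same]
        rw [← s.2.2]
        exact Finset.single_le_sum (fun m _ => division_nonneg s m) (Finset.mem_univ j)
      · rw [Function.update_of_ne hj]
        simp [demandAll, Lottery.expect_dirac]
  · refine ⟨s.1 i, ?_, fun τ u' hu' => ?_⟩
    · simp only [HasPayoff, nodeValue, voteStage_of_k_eq_one hk]
      exact tendsto_const_nhds
    · simp only [HasPayoff, nodeValue, voteStage_of_k_eq_one hk] at hu'
      exact (tendsto_nhds_unique tendsto_const_nhds hu').ge

theorem IsContestEq.isOutcome (hn : 2 ≤ n) (hE : E.Regular) (hk : r.k = 1)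
    (h : IsContestEq E r x) : IsOutcome E r x (recognition E r x) := by
  -- Votes are irrelevant when `k = 1`; the acceptance thresholds are chosen only to meet
  -- `VotesAsPivotal`.
  refine ⟨⟨demandAll x fun i => E.δ i * (recognition E r x i - E.c i (x i)),
    ⟨fun i => ⟨fun _ _ => rfl, fun _ _ _ _ => rfl, fun _ _ _ _ _ _ => rfl⟩,
      isSubgamePerfect_demandAll hn hE hk h _,
      fun i => recognition E r x i - E.c i (x i), fun i => ?_, fun i h' z j s _ => ?_⟩,
    fun _ _ => rfl⟩, rfl⟩
  · exact hasPayoff_start_demandAll hk _ i []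
  · simp [demandAll]

theorem IsOutcome.exists_isStationaryPayoff (hn : 2 ≤ n) (hE : E.Regular)
    (hδ : ∀ i, 0 < E.δ i ∧ E.δ i < 1) {p : Fin n → ℝ} (h : IsOutcome E r x p) :
    ∃ u v, IsStationaryPayoff E r x u v := by
  obtain ⟨⟨σ, hσ, hx⟩, -⟩ := h
  exact hσ.exists_isStationaryPayoff hn hE hδ hx

/-- With `k = 1` each proposer gets the full dollar and the others nothing, so `prize` equals one
and `linearized` is the contest condition. The case of certain recognition, where `prize` has
denominator zero, is separate. -/
theorem IsOutcome.isContestEq (hn : 2 ≤ n) (hE : E.Regular) (hδ : ∀ i, 0 < E.δ i ∧ E.δ i < 1)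
    (hk : r.k = 1) {p : Fin n → ℝ} (h : IsOutcome E r x p) : IsContestEq E r x := by
  obtain ⟨u, v, huv⟩ := h.exists_isStationaryPayoff hn hE hδ
  have hS := huv.totalImpact_pos hn hE hδ
  have hself : ∀ i, u i i = 1 := fun i => le_antisymm ((Finset.single_le_sum (f := fun j => u j i)
    (fun j _ => huv.u_nonneg j i) (Finset.mem_univ i)).trans (huv.sum_u_le i))
    (huv.u_self_of_k_eq_one hk i)
  have hother : ∀ i j, j ≠ i → u i j = 0 := by
    intro i j hj
    have h1 := huv.sum_u_le j
    rw [← Finset.add_sum_erase _ _ (Finset.mem_univ j), hself j] at h1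
    have h2 := Finset.single_le_sum (f := fun m => u m j) (s := Finset.univ.erase j)
      (fun m _ => huv.u_nonneg m j) (Finset.mem_erase.2 ⟨hj.symm, Finset.mem_univ i⟩)
    exact le_antisymm (by linarith) (huv.u_nonneg i j)
  refine ⟨hS, fun i y => ?_⟩
  rcases (recognition_le_one hn hE r x i).lt_or_eq with hi | hi
  · have hW : prize E r x u i = 1 := by
      rw [prize, hself, Finset.sum_eq_zero, zero_div, sub_zero]
      intro j hj
      rw [hother i j (Finset.ne_of_mem_erase hj), mul_zero]
    simpa [hW] using huv.linearized hE hS hi y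
  · rw [hi, huv.effort_eq_zero_of_recognition_eq_one hn hE hδ hi]
    simp only [sub_self, mul_zero, zero_div, zero_mul, Pi.zero_apply, NNReal.coe_zero, hE.c_zero i,
      sub_zero]
    exact c_nonneg hE i y

/-! ### Uniqueness of the contest equilibrium -/

/-- First-order conditions with a smaller marginal return cannot select a larger effort. -/
theorem le_of_linearized (hE : E.Regular) {i : Fin n} {y z : ℝ≥0} {γ γ' : ℝ} (hγ : γ' < γ)
    (hy : ∀ t : ℝ≥0, γ * (E.f i t - E.f i y) ≤ E.c i t - E.c i y)
    (hz : ∀ t : ℝ≥0, γ' * (E.f i t - E.f i z) ≤ E.c i t - E.c i z) : z ≤ y := by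
  by_contra! hlt
  have h1 := hy z
  have h2 := hz y
  have h3 := f_strictMono hE i hlt
  simp only at h3
  nlinarith

theorem lt_of_impact_lt (hE : E.Regular) {i : Fin n} {y z : ℝ≥0}
    (h : impact E r i y < impact E r i z) : y < z := by
  by_contra! hle
  have := mul_le_mul_of_nonneg_left ((f_strictMono hE i).monotone hle) (r.α_nonneg i)
  simp only [impact] at h
  linarith

theorem α_pos_of_impact_lt {i : Fin n} {y z : ℝ≥0} (h : impact E r i y < impact E r i z) :
    0 < r.α i := by
  refine lt_of_le_of_ne (r.α_nonneg i) fun h0 => ?_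
  simp only [impact, ← h0] at h
  linarith

theorem effort_eq_zero_of_marginal_eq_zero (hE : E.Regular) (h : IsContestEq E r x) {i : Fin n}
    (hi : r.α i * (1 - recognition E r x i) = 0) : x i = 0 := by
  refine eq_zero_of_forall_cost_le hE (i := i) fun y => ?_
  have := h.2 i y
  rwa [hi, zero_div, zero_mul] at this

/-- Let `x'` have the larger total impact. An agent recognized with higher probability at `x'` would
exert more effort there, although a larger total and a larger own probability both lower the
marginal return. So no probability rises, and as both profiles sum to one they coincide. -/
theorem IsContestEq.unique_of_le (hn : 2 ≤ n) (hE : E.Regular) {x' : Fin n → ℝ≥0}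
    (h : IsContestEq E r x) (h' : IsContestEq E r x')
    (hle : totalImpact E r x ≤ totalImpact E r x') : x = x' := by
  have himp : ∀ i, impact E r i (x i) = recognition E r x i * totalImpact E r x := fun i => by
    rw [recognition_of_pos h.1, div_mul_cancel₀ _ h.1.ne']
  have himp' : ∀ i, impact E r i (x' i) = recognition E r x' i * totalImpact E r x' := fun i => by
    rw [recognition_of_pos h'.1, div_mul_cancel₀ _ h'.1.ne']
  have hp : ∀ i, recognition E r x' i ≤ recognition E r x i := by
    intro i
    by_contra! hlt
    have himpact : impact E r i (x i) < impact E r i (x' i) := by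
      rw [himp, himp']
      nlinarith [h.1, recognition_nonneg hE r x i]
    refine absurd (le_of_linearized hE (i := i) ?_ (h.2 i) (h'.2 i))
      (not_le.2 (lt_of_impact_lt hE himpact))
    have hα := α_pos_of_impact_lt himpact
    rw [div_lt_div_iff₀ h'.1 h.1]
    have := recognition_le_one hn hE r x' i
    have h1 : (1 - recognition E r x' i) * totalImpact E r x <
        (1 - recognition E r x i) * totalImpact E r x' := by nlinarith [h.1]
    nlinarith
  have hpeq : ∀ i, recognition E r x' i = recognition E r x i := by
    have := (Finset.sum_eq_sum_iff_of_le fun i (_ : i ∈ Finset.univ) => hp i).1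
      ((sum_recognition hn E r x').trans (sum_recognition hn E r x).symm)
    exact fun i => this i (Finset.mem_univ i)
  -- With equal probabilities, a larger total would require more effort from any agent with positive
  -- probability, at a lower marginal return, or at zero return if that probability is one.
  have hSeq : totalImpact E r x = totalImpact E r x' := by
    refine hle.eq_or_lt.resolve_right fun hlt => ?_
    obtain ⟨i, hi⟩ : ∃ i, 0 < recognition E r x i := by
      by_contra! hcon
      have := Finset.sum_nonpos fun i (_ : i ∈ Finset.univ) => hcon i
      rw [sum_recognition hn] at this
      linarith
    have himpact : impact E r i (x i) < impact E r i (x' i) := by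
      rw [himp, himp', hpeq]
      nlinarith
    have hx := lt_of_impact_lt hE himpact
    have hα := α_pos_of_impact_lt himpact
    rcases (recognition_le_one hn hE r x i).lt_or_eq with hi1 | hi1
    · refine absurd (le_of_linearized hE (i := i) ?_ (h.2 i) (h'.2 i)) (not_le.2 hx)
      rw [hpeq, div_lt_div_iff₀ h'.1 h.1]
      have := mul_pos hα (sub_pos.2 hi1)
      nlinarith
    · have h1 : x' i = 0 := effort_eq_zero_of_marginal_eq_zero hE h' (by rw [hpeq, hi1, sub_self, mul_zero])
      rw [h1] at hx
      exact absurd hx not_lt_zero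
  funext i
  rcases (r.α_nonneg i).eq_or_lt with hα | hα
  · rw [effort_eq_zero_of_marginal_eq_zero hE h (by rw [← hα, zero_mul]),
      effort_eq_zero_of_marginal_eq_zero hE h' (by rw [← hα, zero_mul])]
  · refine (f_strictMono hE i).injective ?_
    have h1 : impact E r i (x i) = impact E r i (x' i) := by rw [himp, himp', hpeq, hSeq]
    simp only [impact, add_left_inj] at h1
    exact mul_left_cancel₀ hα.ne' h1

theorem IsContestEq.isUniqueOutcome (hn : 2 ≤ n) (hE : E.Regular)
    (hδ : ∀ i, 0 < E.δ i ∧ E.δ i < 1) (hk : r.k = 1) (h : IsContestEq E r x) :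
    IsUniqueOutcome E r x (recognition E r x) := by
  refine ⟨h.isOutcome hn hE hk, fun x' p' h' => ?_⟩
  have hx : x' = x := by
    have hc := h'.isContestEq hn hE hδ hk
    rcases le_total (totalImpact E r x) (totalImpact E r x') with hle | hle
    · exact (h.unique_of_le hn hE hc hle).symm
    · exact hc.unique_of_le hn hE h hle
  refine ⟨hx, ?_⟩
  rw [← hx]
  exact h'.2

end

section


variable {n : ℕ} {E : Environment n} {r : Rule n} {x : Fin n → ℝ≥0} {p : Fin n → ℝ}

/-! ### Implementation without approval -/

theorem IsOutcome.mem_stdSimplex (hn : 2 ≤ n) (hE : E.Regular) (h : IsOutcome E r x p) :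
    p ∈ stdSimplex ℝ (Fin n) := by
  rw [h.2]
  exact ⟨recognition_nonneg hE r x, sum_recognition hn E r x⟩

theorem eq_single_of_mem_stdSimplex (hp : p ∈ stdSimplex ℝ (Fin n)) {i : Fin n} (hi : p i = 1) :
    p = Pi.single i 1 := by
  have h1 := hp.2
  rw [← Finset.add_sum_erase _ _ (Finset.mem_univ i), hi, add_eq_left,
    Finset.sum_eq_zero_iff_of_nonneg fun j _ => hp.1 j] at h1
  funext j
  by_cases hj : j = i
  · subst hj
    simpa using hi
  · rw [Pi.single_eq_of_ne hj]
    exact h1 j (by simp [hj])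

theorem recognition_eq_of_impact_eq {q : Fin n → ℝ} (hq : ∑ i, q i = 1)
    (h : ∀ i, impact E r i (x i) = q i) :
    totalImpact E r x = 1 ∧ recognition E r x = q := by
  have h1 : totalImpact E r x = 1 := by simp only [totalImpact, h, hq]
  refine ⟨h1, funext fun i => ?_⟩
  rw [recognition_of_pos (h1 ▸ one_pos), h1, h, div_one]

/-- The rule under which agent `i` is recognized with certainty. -/
def dictatorship (hn : 2 ≤ n) (i : Fin n) : Rule n where
  α := Pi.single i 1
  β := Pi.single i 1
  k := 1
  α_nonneg := (single_mem_stdSimplex ℝ i).1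
  α_ne_zero := by simp
  β_nonneg := (single_mem_stdSimplex ℝ i).1
  one_le_k := le_rfl
  k_le := by omega

/-- `α j * (1 - p j)` vanishes for everyone: only the dictator has a nonzero bias, and he is already
certain. Hence nobody gains from effort. -/
theorem isContestEq_dictatorship (hn : 2 ≤ n) (hE : E.Regular) (i : Fin n) :
    IsContestEq E (dictatorship hn i) 0 ∧
      recognition E (dictatorship hn i) 0 = Pi.single i 1 := by
  obtain ⟨h1, h2⟩ := recognition_eq_of_impact_eq (E := E) (r := dictatorship hn i) (x := 0)
    (q := Pi.single i 1) (single_mem_stdSimplex ℝ i).2 fun j => by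
      simp [impact, hE.f_zero j, dictatorship]
  refine ⟨⟨h1 ▸ one_pos, fun j y => ?_⟩, h2⟩
  have h0 : (dictatorship hn i).α j * (1 - (Pi.single i 1 : Fin n → ℝ) j) = 0 := by
    by_cases hj : j = i
    · subst hj
      simp
    · simp [dictatorship, hj]
  rw [h2, h0]
  simp only [zero_div, zero_mul, Pi.zero_apply, NNReal.coe_zero, hE.c_zero j, sub_zero]
  exact c_nonneg hE j y

theorem IsOutcome.eq_of_recognition_eq_one (hn : 2 ≤ n) (hE : E.Regular)
    (hδ : ∀ i, 0 < E.δ i ∧ E.δ i < 1) (h : IsOutcome E r x p) {i : Fin n} (hi : p i = 1) :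
    x = 0 ∧ p = Pi.single i 1 := by
  obtain ⟨u, v, huv⟩ := h.exists_isStationaryPayoff hn hE hδ
  exact ⟨huv.effort_eq_zero_of_recognition_eq_one hn hE hδ (h.2 ▸ hi),
    eq_single_of_mem_stdSimplex (h.mem_stdSimplex hn hE) hi⟩

/-- Positive effort requires a positive prize and a positive bias. If all efforts are zero, any
agent with `α i > 0` works: `v i` averages `u i i` and the payoff without recognition, so `v i < u i
i` makes the prize positive. -/
theorem IsStationaryPayoff.exists_prize_pos (hn : 2 ≤ n) (hE : E.Regular)
    (hδ : ∀ i, 0 < E.δ i ∧ E.δ i < 1) {u : Fin n → Fin n → ℝ} {v : Fin n → ℝ}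
    (h : IsStationaryPayoff E r x u v) (hp : ∀ i, recognition E r x i < 1) :
    ∃ i, 0 < prize E r x u i ∧ 0 < r.α i := by
  have hS := h.totalImpact_pos hn hE hδ
  by_cases hx : x = 0
  · obtain ⟨i, hi⟩ := Function.ne_iff.1 r.α_ne_zero
    refine ⟨i, ?_, lt_of_le_of_ne (r.α_nonneg i) (Ne.symm hi)⟩
    have hlt := h.payoff_lt_of_effort_eq_zero hn hE hδ hx (hp i)
    have hA : 0 < totalImpact E r x - impact E r i (x i) := by
      have := hp i
      rw [recognition_of_pos hS, div_lt_one hS] at this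
      linarith
    have hc : E.c i (x i) = 0 := by simp [hx, hE.c_zero i]
    rw [h.v_eq i, hc, sum_recognition_mul hS _ i, neg_zero, zero_add, div_lt_iff₀ hS] at hlt
    rw [prize, sub_pos, div_lt_iff₀ hA]
    linarith
  · obtain ⟨i, hi⟩ := Function.ne_iff.1 hx
    refine ⟨i, ?_⟩
    by_contra hcon
    refine hi (eq_zero_of_forall_cost_le hE (i := i) fun y => ?_)
    have h0 : max (prize E r x u i) 0 * r.α i = 0 := by
      rcases le_or_gt (prize E r x u i) 0 with hW | hW
      · rw [max_eq_right hW, zero_mul]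
      · rw [le_antisymm (not_lt.1 fun hα => hcon ⟨hW, hα⟩) (r.α_nonneg i), mul_zero]
    have := h.linearized hE hS (hp i) y
    rwa [h0, zero_mul, zero_div, zero_mul] at this

/-- The weaker incentive from a prize below one is replicated by a smaller multiplicative bias in a
contest for the whole dollar. -/
theorem IsOutcome.exists_isContestEq (hn : 2 ≤ n) (hE : E.Regular)
    (hδ : ∀ i, 0 < E.δ i ∧ E.δ i < 1) (h : IsOutcome E r x p) :
    ∃ r' : Rule n, r'.k = 1 ∧ IsContestEq E r' x ∧ recognition E r' x = p := by
  by_cases hp : ∃ i, p i = 1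
  · obtain ⟨i, hi⟩ := hp
    obtain ⟨rfl, rfl⟩ := h.eq_of_recognition_eq_one hn hE hδ hi
    exact ⟨dictatorship hn i, rfl, isContestEq_dictatorship hn hE i⟩
  obtain ⟨u, v, huv⟩ := h.exists_isStationaryPayoff hn hE hδ
  have hS := huv.totalImpact_pos hn hE hδ
  have hlt : ∀ i, recognition E r x i < 1 := fun i =>
    lt_of_le_of_ne (recognition_le_one hn hE r x i) fun hi => hp ⟨i, h.2 ▸ hi⟩
  obtain ⟨i₀, hW, hα⟩ := huv.exists_prize_pos hn hE hδ hlt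
  have hle : ∀ i, max (prize E r x u i) 0 * r.α i ≤ r.α i := fun i =>
    mul_le_of_le_one_left (r.α_nonneg i) (max_le (huv.prize_le_one hE i) zero_le_one)
  let r' : Rule n :=
    { α := fun i => max (prize E r x u i) 0 * r.α i
      -- The headstart restores the original impact at `x i`, leaving total impact and probabilities
      -- unchanged.
      β := fun i => impact E r i (x i) - max (prize E r x u i) 0 * r.α i * E.f i (x i)
      k := 1
      α_nonneg := fun i => mul_nonneg (le_max_right _ _) (r.α_nonneg i)
      α_ne_zero := fun h0 => (mul_pos (lt_max_of_lt_left hW) hα).ne' (congrFun h0 i₀)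
      β_nonneg := fun i => by
        have h1 := mul_le_mul_of_nonneg_right (hle i) (f_nonneg hE i (x i))
        have h2 := r.β_nonneg i
        simp only [impact]
        linarith
      one_le_k := le_rfl
      k_le := by omega }
  have himp : ∀ i, impact E r' i (x i) = impact E r i (x i) := fun i => by
    change max (prize E r x u i) 0 * r.α i * E.f i (x i) +
      (impact E r i (x i) - max (prize E r x u i) 0 * r.α i * E.f i (x i)) = _
    ring
  have hT : totalImpact E r' x = totalImpact E r x := by simp only [totalImpact, himp]
  have hrec : recognition E r' x = recognition E r x := by
    funext i
    rw [recognition_of_pos hS, recognition_of_pos (hT ▸ hS), hT, himp]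
  refine ⟨r', rfl, ⟨hT ▸ hS, fun i y => ?_⟩, hrec.trans h.2.symm⟩
  rw [hT, hrec]
  exact huv.linearized hE hS (hlt i) y

/-! ### Efforts without headstarts -/

theorem tangent_le_of_convexOn {S : Set ℝ} {g : ℝ → ℝ} (hg : ConvexOn ℝ S g) {z y : ℝ}
    (hz : z ∈ S) (hy : y ∈ S) (hd : DifferentiableAt ℝ g z) :
    g z + deriv g z * (y - z) ≤ g y := by
  rcases lt_trichotomy z y with h | h | h
  · have h1 := hg.deriv_le_slope hz hy h hd
    rw [slope_def_field, le_div_iff₀ (sub_pos.2 h)] at h1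
    linarith
  · simp [h]
  · have h1 := hg.slope_le_deriv hy hz h hd
    rw [slope_def_field, div_le_iff₀ (sub_pos.2 h)] at h1
    linarith

theorem c_tangent (hE : E.Regular) (i : Fin n) {z y : ℝ} (hz : 0 < z) (hy : 0 ≤ y) :
    E.c i z + deriv (E.c i) z * (y - z) ≤ E.c i y :=
  tangent_le_of_convexOn (c_convexOn hE i) hz.le hy
    ((hE.c_diff i).differentiableAt (Ioi_mem_nhds hz))

theorem f_tangent (hE : E.Regular) (i : Fin n) {z y : ℝ} (hz : 0 < z) (hy : 0 ≤ y) :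
    E.f i y ≤ E.f i z + deriv (E.f i) z * (y - z) := by
  have h := tangent_le_of_convexOn (f_concaveOn hE i).neg (Set.mem_Ici.2 hz.le) (Set.mem_Ici.2 hy)
    ((hE.f_diff i).differentiableAt (Ioi_mem_nhds hz)).neg
  rw [deriv.neg] at h
  simp only [Pi.neg_apply] at h
  linarith

theorem deriv_f_antitoneOn (hE : E.Regular) (i : Fin n) :
    AntitoneOn (deriv (E.f i)) (Set.Ioi 0) := by
  refine antitoneOn_of_deriv_nonpos (convex_Ioi 0) (hE.f_diff₂ i).continuousOn ?_ ?_
  · rw [interior_Ioi]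
    exact hE.f_diff₂ i
  · rw [interior_Ioi]
    exact hE.f_deriv₂_nonpos i

theorem deriv_c_monotoneOn (hE : E.Regular) (i : Fin n) :
    MonotoneOn (deriv (E.c i)) (Set.Ioi 0) := by
  refine monotoneOn_of_deriv_nonneg (convex_Ioi 0) (hE.c_diff₂ i).continuousOn ?_ ?_
  · rw [interior_Ioi]
    exact hE.c_diff₂ i
  · rw [interior_Ioi]
    exact hE.c_deriv₂_nonneg i

theorem f_pos (hE : E.Regular) (i : Fin n) {z : ℝ} (hz : 0 < z) : 0 < E.f i z := by
  have := f_strictMonoOn hE i (Set.mem_Ici.2 le_rfl) (Set.mem_Ici.2 hz.le) hz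
  rwa [hE.f_zero i] at this

/-- The value of `p (1 - p)` for which an agent without a headstart who is recognized with
probability `p` exerts effort `x`. -/
def requiredSpread (E : Environment n) (i : Fin n) (x : ℝ≥0) : ℝ≥0 :=
  Real.toNNReal (E.f i x * deriv (E.c i) x / deriv (E.f i) x)

theorem requiredSpread_strictMono (hE : E.Regular) (i : Fin n) :
    StrictMono (requiredSpread E i) := by
  intro x y hxy
  have hy : (0 : ℝ) < y := lt_of_le_of_lt x.2 hxy
  have hpos : ∀ z : ℝ, 0 < z → 0 < E.f i z * deriv (E.c i) z / deriv (E.f i) z := fun z hz =>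
    div_pos (mul_pos (f_pos hE i hz) (hE.c_deriv_pos i z hz)) (hE.f_deriv_pos i z hz)
  refine (Real.toNNReal_lt_toNNReal_iff (hpos y hy)).2 ?_
  rcases (zero_le (a := x)).eq_or_lt with hx | hx
  · simpa [← hx, hE.f_zero i] using hpos y hy
  have hx' : (0 : ℝ) < x := hx
  have h1 := f_strictMono hE i hxy
  have h2 := deriv_c_monotoneOn hE i hx' hy (le_of_lt hxy)
  have h3 := deriv_f_antitoneOn hE i hx' hy (le_of_lt hxy)
  refine div_lt_div₀ ?_ h3 (mul_pos (f_pos hE i hy) (hE.c_deriv_pos i y hy)).le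
    (hE.f_deriv_pos i y hy)
  exact mul_lt_mul h1 h2 (hE.c_deriv_pos i x hx') (f_pos hE i hy).le

/-- Intermediate values: near zero `f` is small while `c'` is bounded above and `f'` bounded below;
far out, concavity gives `f b ≥ b * f' b` and `b * c' b` reaches `κ`. -/
theorem exists_marginal_eq (hE : E.Regular) (i : Fin n) {κ : ℝ} (hκ : 0 < κ) :
    ∃ z : ℝ, 0 < z ∧ E.f i z * deriv (E.c i) z = κ * deriv (E.f i) z := by
  have hc1 := hE.c_deriv_pos i 1 one_pos
  have hf1 := hE.f_deriv_pos i 1 one_pos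
  obtain ⟨a, ha, ha1, hfa⟩ : ∃ a : ℝ, 0 < a ∧ a ≤ 1 ∧
      E.f i a < κ * deriv (E.f i) 1 / deriv (E.c i) 1 := by
    have hlim : Tendsto (E.f i) (𝓝[>] 0) (𝓝 0) := by
      have h1 : Tendsto (E.f i) (𝓝[≥] 0) (𝓝 (E.f i 0)) := hE.f_cont i 0 Set.self_mem_Ici
      rw [hE.f_zero i] at h1
      exact h1.mono_left (nhdsWithin_mono _ Set.Ioi_subset_Ici_self)
    have hpos : 0 < κ * deriv (E.f i) 1 / deriv (E.c i) 1 := by positivity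
    obtain ⟨a, h1, h2⟩ := ((hlim.eventually (gt_mem_nhds hpos)).and
      (Ioc_mem_nhdsGT (zero_lt_one' ℝ))).exists
    exact ⟨a, h2.1, h2.2, h1⟩
  let b := max 1 (κ / deriv (E.c i) 1)
  have hb1 : 1 ≤ b := le_max_left _ _
  have hb : 0 < b := one_pos.trans_le hb1
  have hcont : ContinuousOn (fun z => E.f i z * deriv (E.c i) z - κ * deriv (E.f i) z)
      (Set.Icc a b) := by
    have hsub : Set.Icc a b ⊆ Set.Ioi 0 := fun z hz => ha.trans_le hz.1
    exact (((hE.f_diff i).continuousOn.mul (hE.c_diff₂ i).continuousOn).sub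
      ((hE.f_diff₂ i).continuousOn.const_mul κ)).mono hsub
  have hleft : E.f i a * deriv (E.c i) a - κ * deriv (E.f i) a ≤ 0 := by
    have h2 := deriv_c_monotoneOn hE i (Set.mem_Ioi.2 ha) (Set.mem_Ioi.2 one_pos) ha1
    have h3 := deriv_f_antitoneOn hE i (Set.mem_Ioi.2 ha) (Set.mem_Ioi.2 one_pos) ha1
    rw [lt_div_iff₀ hc1] at hfa
    nlinarith [f_pos hE i ha]
  have hright : 0 ≤ E.f i b * deriv (E.c i) b - κ * deriv (E.f i) b := by
    have h1 := f_tangent hE i hb (le_refl 0)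
    rw [hE.f_zero i] at h1
    have h2 := deriv_c_monotoneOn hE i (Set.mem_Ioi.2 one_pos) (Set.mem_Ioi.2 hb) hb1
    have h3 : κ ≤ b * deriv (E.c i) b := by
      have : κ / deriv (E.c i) 1 ≤ b := le_max_right _ _
      rw [div_le_iff₀ hc1] at this
      nlinarith
    have h4 := hE.f_deriv_pos i b hb
    have h5 := hE.c_deriv_pos i b hb
    nlinarith
  obtain ⟨z, hz, hz0⟩ := intermediate_value_Icc (ha1.trans hb1) hcont ⟨hleft, hright⟩
  exact ⟨z, ha.trans_le hz.1, sub_eq_zero.1 hz0⟩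

theorem requiredSpread_surjective (hE : E.Regular) (i : Fin n) :
    Function.Surjective (requiredSpread E i) := by
  intro κ
  rcases (zero_le (a := κ)).eq_or_lt with hκ | hκ
  -- At zero effort the factor `f 0 = 0` makes the values of `deriv` at `0` immaterial.
  · exact ⟨0, by simp [requiredSpread, hE.f_zero i, ← hκ]⟩
  · obtain ⟨z, hz, h⟩ := exists_marginal_eq hE i (κ := κ) hκ
    refine ⟨⟨z, hz.le⟩, ?_⟩
    have h1 : E.f i z * deriv (E.c i) z / deriv (E.f i) z = κ := by
      rw [h, mul_div_cancel_right₀ _ (hE.f_deriv_pos i z hz).ne']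
    change Real.toNNReal (E.f i z * deriv (E.c i) z / deriv (E.f i) z) = κ
    rw [h1, Real.toNNReal_coe]

/-- The effort of agent `i` in a contest without headstarts in which his recognition probability
`p` satisfies `p (1 - p) = κ`. -/
def spreadEffort (hE : E.Regular) (i : Fin n) : ℝ≥0 ≃o ℝ≥0 :=
  ((requiredSpread_strictMono hE i).orderIsoOfSurjective _ (requiredSpread_surjective hE i)).symm

theorem requiredSpread_spreadEffort (hE : E.Regular) (i : Fin n) (κ : ℝ≥0) :
    requiredSpread E i (spreadEffort hE i κ) = κ :=
  ((requiredSpread_strictMono hE i).orderIsoOfSurjective _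
    (requiredSpread_surjective hE i)).apply_symm_apply κ

theorem spreadEffort_zero (hE : E.Regular) (i : Fin n) : spreadEffort hE i 0 = 0 :=
  (spreadEffort hE i).map_bot

theorem spreadEffort_pos (hE : E.Regular) (i : Fin n) {κ : ℝ≥0} (hκ : 0 < κ) :
    0 < spreadEffort hE i κ := by
  rw [← spreadEffort_zero hE i]
  exact (spreadEffort hE i).strictMono hκ

theorem spreadEffort_linearized (hE : E.Regular) (i : Fin n) {κ : ℝ≥0} (hκ : 0 < κ) (y : ℝ≥0) :
    κ / E.f i (spreadEffort hE i κ) * (E.f i y - E.f i (spreadEffort hE i κ)) ≤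
      E.c i y - E.c i (spreadEffort hE i κ) := by
  have hz : (0 : ℝ) < spreadEffort hE i κ := spreadEffort_pos hE i hκ
  have hsp := congrArg NNReal.toReal (requiredSpread_spreadEffort hE i κ)
  generalize (spreadEffort hE i κ) = z at *
  have hfz := f_pos hE i hz
  have hf' := hE.f_deriv_pos i z hz
  rw [requiredSpread, Real.coe_toNNReal _
    (div_pos (mul_pos hfz (hE.c_deriv_pos i z hz)) hf').le] at hsp
  have hγ : (κ : ℝ) / E.f i z * deriv (E.f i) z = deriv (E.c i) z := by
    rw [← hsp]
    field_simp
  have h1 := f_tangent hE i hz y.coe_nonneg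
  have h2 := c_tangent hE i hz y.coe_nonneg
  have h3 : (κ : ℝ) / E.f i z * (E.f i y - E.f i z) ≤
      κ / E.f i z * (deriv (E.f i) z * (y - z)) := by
    refine mul_le_mul_of_nonneg_left ?_ (by positivity)
    linarith
  rw [← mul_assoc, hγ] at h3
  linarith

/-- The efforts in the contest without headstarts with recognition probabilities `p`. -/
def contestEffort (hE : E.Regular) (p : Fin n → ℝ) (i : Fin n) : ℝ≥0 :=
  spreadEffort hE i (Real.toNNReal (p i * (1 - p i)))

/-- No regularity of the inverse has to be checked: an order isomorphism is continuous. -/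
theorem continuous_contestEffort (hE : E.Regular) : Continuous (contestEffort hE) := by
  refine continuous_pi fun i => (spreadEffort hE i).continuous.comp ?_
  fun_prop

theorem contestEffort_eq_zero (hE : E.Regular) {i : Fin n} (h : p i * (1 - p i) = 0) :
    contestEffort hE p i = 0 := by
  rw [contestEffort, h, Real.toNNReal_zero, spreadEffort_zero]

theorem contestEffort_single (hE : E.Regular) (i : Fin n) :
    contestEffort hE (Pi.single i 1) = 0 := by
  funext j
  refine contestEffort_eq_zero hE ?_
  by_cases hj : j = i
  · subst hj
    simp
  · simp [hj]

theorem contestEffort_linearized (hE : E.Regular) {i : Fin n} (h : 0 < p i * (1 - p i)) (y : ℝ≥0) :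
    p i * (1 - p i) / E.f i (contestEffort hE p i) * (E.f i y - E.f i (contestEffort hE p i)) ≤
      E.c i y - E.c i (contestEffort hE p i) := by
  have := spreadEffort_linearized hE i (Real.toNNReal_pos.2 h) y
  rwa [Real.coe_toNNReal _ h.le] at this

theorem contestEffort_pos (hE : E.Regular) {i : Fin n} (h : 0 < p i * (1 - p i)) :
    0 < contestEffort hE p i :=
  spreadEffort_pos hE i (Real.toNNReal_pos.2 h)

/-- Choosing `α i = p i / f i (x i)` at the target efforts normalizes impacts to `p i` and their
total to one. If `p i = 0`, the effort is zero and the quotient `0 / 0 = 0` gives the required zero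
bias. -/
theorem exists_isContestEq_contestEffort (hn : 2 ≤ n) (hE : E.Regular)
    (hp : p ∈ stdSimplex ℝ (Fin n)) (hlt : ∀ i, p i < 1) :
    ∃ r' : Rule n, r'.k = 1 ∧ r'.β = 0 ∧ IsContestEq E r' (contestEffort hE p) ∧
      recognition E r' (contestEffort hE p) = p := by
  have hsp : ∀ i, 0 < p i → 0 < p i * (1 - p i) := fun i hi => mul_pos hi (sub_pos.2 (hlt i))
  have hf : ∀ i, 0 < p i → 0 < E.f i (contestEffort hE p i) := fun i hi =>
    f_pos hE i (contestEffort_pos hE (hsp i hi))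
  let r' : Rule n :=
    { α := fun i => p i / E.f i (contestEffort hE p i)
      β := 0
      k := 1
      α_nonneg := fun i => div_nonneg (hp.1 i) (f_nonneg hE i _)
      α_ne_zero := fun h0 => by
        obtain ⟨i, -, hi⟩ := Finset.exists_lt_of_sum_lt (s := Finset.univ)
          (f := fun _ => (0 : ℝ)) (g := p) (by simp [hp.2])
        exact (div_pos hi (hf i hi)).ne' (congrFun h0 i)
      β_nonneg := fun _ => le_rfl
      one_le_k := le_rfl
      k_le := by omega }
  have himp : ∀ i, impact E r' i (contestEffort hE p i) = p i := by
    intro i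
    change p i / E.f i (contestEffort hE p i) * E.f i (contestEffort hE p i) + 0 = p i
    rcases (hp.1 i).eq_or_lt with hi | hi
    · simp [← hi]
    · rw [div_mul_cancel₀ _ (hf i hi).ne', add_zero]
  obtain ⟨hT, hrec⟩ := recognition_eq_of_impact_eq hp.2 himp
  refine ⟨r', rfl, rfl, ⟨hT ▸ one_pos, fun i y => ?_⟩, hrec⟩
  rw [hT, hrec, div_one]
  change p i / E.f i (contestEffort hE p i) * (1 - p i) * _ ≤ _
  rcases (hp.1 i).eq_or_lt with hi | hi
  · rw [contestEffort_eq_zero hE (by rw [← hi, zero_mul]), ← hi]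
    simp only [zero_div, zero_mul, NNReal.coe_zero, hE.c_zero i, sub_zero]
    exact c_nonneg hE i y
  · rw [div_mul_eq_mul_div]
    exact contestEffort_linearized hE (hsp i hi) y

/-- A headstart supplies part of the impact, so the bias, and with it the marginal return, is
smaller than if effort alone produced `p i`. An effort above `contestEffort` would contradict
`le_of_linearized`. -/
theorem IsContestEq.le_contestEffort (hE : E.Regular) (h : IsContestEq E r x)
    (hrec : recognition E r x = p) (hlt : ∀ i, p i < 1) : x ≤ contestEffort hE p := by
  intro i
  have himp : impact E r i (x i) = p i * totalImpact E r x := by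
    rw [← hrec, recognition_of_pos h.1, div_mul_cancel₀ _ h.1.ne']
  have hαf : r.α i * E.f i (x i) ≤ p i * totalImpact E r x := by
    have := r.β_nonneg i
    simp only [impact] at himp
    linarith
  have hp0 : 0 ≤ p i := hrec ▸ recognition_nonneg hE r x i
  by_contra! hgt
  have hxi : 0 < E.f i (x i) :=
    f_pos hE i (lt_of_le_of_lt (contestEffort hE p i).2 (NNReal.coe_lt_coe.2 hgt))
  rcases hp0.eq_or_lt with hi | hi
  · rw [← hi, zero_mul] at hαf
    have hα : r.α i = 0 := by
      refine le_antisymm (not_lt.1 fun hα => ?_) (r.α_nonneg i)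
      linarith [mul_pos hα hxi]
    rw [effort_eq_zero_of_marginal_eq_zero hE h (by rw [hα, zero_mul])] at hgt
    exact absurd hgt not_lt_zero
  · have hsp := mul_pos hi (sub_pos.2 (hlt i))
    have hfz := f_pos hE i (NNReal.coe_pos.2 (contestEffort_pos hE hsp))
    refine absurd (le_of_linearized hE (i := i) ?_ (contestEffort_linearized hE hsp) (h.2 i))
      (not_le.2 hgt)
    rw [hrec, div_lt_div_iff₀ h.1 hfz]
    have hf := f_strictMono hE i hgt
    have h1 : r.α i * E.f i (contestEffort hE p i) < p i * totalImpact E r x := by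
      rcases (r.α_nonneg i).eq_or_lt with hα | hα
      · rw [← hα, zero_mul]
        exact mul_pos hi h.1
      · exact (mul_lt_mul_of_pos_left hf hα).trans_le hαf
    have := mul_lt_mul_of_pos_left h1 (sub_pos.2 (hlt i))
    linarith

/-! ### The design problem -/

/-- Raise the coordinates one at a time. -/
theorem EffortMonotone.le_of_le {Λ : (Fin n → ℝ≥0) → (Fin n → ℝ) → ℝ} (hΛ : EffortMonotone Λ)
    (hp : p ∈ stdSimplex ℝ (Fin n)) {y : Fin n → ℝ≥0} (hxy : x ≤ y) : Λ x p ≤ Λ y p := by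
  have key : ∀ s : Finset (Fin n), Λ x p ≤ Λ (s.piecewise y x) p := by
    intro s
    induction s using Finset.induction_on with
    | empty => simp
    | insert a s ha ih =>
      rw [Finset.piecewise_insert]
      refine ih.trans (hΛ p hp _ a _ ?_)
      rw [Finset.piecewise_eq_of_notMem _ _ _ ha]
      exact hxy a
  simpa using key Finset.univ

/-- Points of the simplex without certain recognition approximate every vertex. -/
theorem exists_tendsto_single (hn : 2 ≤ n) (i : Fin n) :
    ∃ q : ℕ → Fin n → ℝ, (∀ m, q m ∈ stdSimplex ℝ (Fin n)) ∧ (∀ m j, q m j < 1) ∧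
      Tendsto q atTop (𝓝 (Pi.single i 1)) := by
  have : Nontrivial (Fin n) := Fin.nontrivial_iff_two_le.2 hn
  obtain ⟨l, hl⟩ := exists_ne i
  -- The shift `2` keeps `t m` strictly between `0` and `1`, so weight moved from vertex `i` to
  -- vertex `l` leaves no coordinate equal to one.
  let t : ℕ → ℝ := fun m => 1 / ((m : ℝ) + 2)
  have ht0 : ∀ m, 0 < t m := fun m => by positivity
  have ht1 : ∀ m, t m < 1 := fun m => by
    rw [div_lt_one (by positivity)]
    linarith [(Nat.cast_nonneg m : (0 : ℝ) ≤ m)]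
  refine ⟨fun m => (1 - t m) • Pi.single i 1 + t m • Pi.single l 1, fun m => ?_, fun m j => ?_, ?_⟩
  · exact convex_stdSimplex ℝ (Fin n) (single_mem_stdSimplex ℝ i) (single_mem_stdSimplex ℝ l)
      (sub_pos.2 (ht1 m)).le (ht0 m).le (by ring)
  · by_cases hji : j = i
    · subst hji
      simpa [hl.symm] using ht0 m
    · by_cases hjl : j = l
      · subst hjl
        simpa [hji] using ht1 m
      · simp [hji, hjl]
  · have ht : Tendsto t atTop (𝓝 0) := by
      refine Tendsto.div_atTop tendsto_const_nhds ?_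
      exact tendsto_atTop_add_const_right _ _ tendsto_natCast_atTop_atTop
    have h1 : Tendsto (fun m => (1 - t m) • (Pi.single i 1 : Fin n → ℝ) +
        t m • (Pi.single l 1 : Fin n → ℝ)) atTop
        (𝓝 (((1 : ℝ) - 0) • (Pi.single i 1 : Fin n → ℝ) + (0 : ℝ) • Pi.single l 1)) :=
      ((ht.const_sub 1).smul_const _).add (ht.smul_const _)
    simpa using h1

/-- This bounds the objective over all rules by a function of `p` alone; at a vertex both effort
profiles are zero. -/
theorem IsOutcome.objective_le (hn : 2 ≤ n) (hE : E.Regular) (hδ : ∀ i, 0 < E.δ i ∧ E.δ i < 1)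
    {Λ : (Fin n → ℝ≥0) → (Fin n → ℝ) → ℝ} (hΛ : EffortMonotone Λ) (h : IsOutcome E r x p) :
    Λ x p ≤ Λ (contestEffort hE p) p := by
  have hmem := h.mem_stdSimplex hn hE
  by_cases hp : ∃ i, p i = 1
  · obtain ⟨i, hi⟩ := hp
    obtain ⟨rfl, rfl⟩ := h.eq_of_recognition_eq_one hn hE hδ hi
    rw [contestEffort_single]
  · obtain ⟨r', -, hc, hrec⟩ := h.exists_isContestEq hn hE hδ
    refine hΛ.le_of_le hmem (hc.le_contestEffort hE hrec fun i => ?_)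
    exact lt_of_le_of_ne (h.2 ▸ recognition_le_one hn hE r x i) fun hi => hp ⟨i, hi⟩

/-- Maximize the bound over the simplex. A maximizer with all `p i < 1` is implementable without
headstarts; a vertex is implemented by a dictatorship and approximated by nearby profiles with `β =
0`. -/
theorem exists_optimal (hn : 2 ≤ n) (hE : E.Regular) (hδ : ∀ i, 0 < E.δ i ∧ E.δ i < 1)
    {Λ : (Fin n → ℝ≥0) → (Fin n → ℝ) → ℝ} (hΛ : EffortMonotone Λ)
    (hcont : ContinuousOn (fun q : (Fin n → ℝ≥0) × (Fin n → ℝ) => Λ q.1 q.2)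
      (Set.univ ×ˢ stdSimplex ℝ (Fin n))) :
    ∃ (r : Rule n) (x : Fin n → ℝ≥0) (p : Fin n → ℝ), r.k = 1 ∧
      IsUniqueOutcome E r x p ∧ IsOptimal E Λ r x p ∧ (r.β = 0 ∨ ∃ i, p i = 1) ∧
      ∀ ε > 0, ∃ (r' : Rule n) (x' : Fin n → ℝ≥0) (p' : Fin n → ℝ),
        r'.k = 1 ∧ r'.β = 0 ∧ IsUniqueOutcome E r' x' p' ∧ Λ x p - ε < Λ x' p' := by
  have hM : ContinuousOn (fun p => Λ (contestEffort hE p) p) (stdSimplex ℝ (Fin n)) :=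
    hcont.comp ((continuous_contestEffort hE).prodMk continuous_id).continuousOn
      fun p hp => ⟨Set.mem_univ _, hp⟩
  obtain ⟨p, hp, hmax⟩ := (isCompact_stdSimplex ℝ (Fin n)).exists_isMaxOn
    ⟨_, single_mem_stdSimplex ℝ (⟨0, by omega⟩ : Fin n)⟩ hM
  have hopt : ∀ r' x' p', IsOutcome E r' x' p' → Λ x' p' ≤ Λ (contestEffort hE p) p :=
    fun r' x' p' h => (h.objective_le hn hE hδ hΛ).trans (hmax (h.mem_stdSimplex hn hE))
  by_cases hone : ∃ i, p i = 1
  · obtain ⟨i, hi⟩ := hone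
    obtain rfl := eq_single_of_mem_stdSimplex hp hi
    obtain ⟨hc, hrec⟩ := isContestEq_dictatorship hn hE i
    have hu := hc.isUniqueOutcome hn hE hδ rfl
    rw [hrec] at hu
    rw [contestEffort_single] at hopt
    refine ⟨dictatorship hn i, 0, Pi.single i 1, rfl, hu, ⟨hu.1, hopt⟩, Or.inr ⟨i, hi⟩,
      fun ε hε => ?_⟩
    obtain ⟨q, hq, hqlt, hqlim⟩ := exists_tendsto_single hn i
    have hlim : Tendsto (fun m => Λ (contestEffort hE (q m)) (q m)) atTop
        (𝓝 (Λ (contestEffort hE (Pi.single i 1)) (Pi.single i 1))) :=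
      (hM _ hp).tendsto.comp (tendsto_nhdsWithin_iff.2 ⟨hqlim, Eventually.of_forall hq⟩)
    rw [contestEffort_single] at hlim
    obtain ⟨m, hm⟩ := (hlim.eventually (lt_mem_nhds (sub_lt_self _ hε))).exists
    obtain ⟨r', hk, hβ, hc', hrec'⟩ := exists_isContestEq_contestEffort hn hE (hq m) (hqlt m)
    have hu' := hc'.isUniqueOutcome hn hE hδ hk
    rw [hrec'] at hu'
    exact ⟨r', _, _, hk, hβ, hu', hm⟩
  · have hlt : ∀ i, p i < 1 := fun i => lt_of_le_of_ne
      (hp.2 ▸ Finset.single_le_sum (fun j _ => hp.1 j) (Finset.mem_univ i))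
      fun hi => hone ⟨i, hi⟩
    obtain ⟨r', hk, hβ, hc, hrec⟩ := exists_isContestEq_contestEffort hn hE hp hlt
    have hu := hc.isUniqueOutcome hn hE hδ hk
    rw [hrec] at hu
    exact ⟨r', _, p, hk, hu, ⟨hu.1, hopt⟩, Or.inl hβ, fun ε hε =>
      ⟨r', _, p, hk, hβ, hu, sub_lt_self _ hε⟩⟩

theorem IsOutcome.exists_isUniqueOutcome (hn : 2 ≤ n) (hE : E.Regular)
    (hδ : ∀ i, 0 < E.δ i ∧ E.δ i < 1) (h : IsOutcome E r x p) :
    ∃ r' : Rule n, r'.k = 1 ∧ IsUniqueOutcome E r' x p := by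
  obtain ⟨r', hk, hc, rfl⟩ := h.exists_isContestEq hn hE hδ
  exact ⟨r', hk, hc.isUniqueOutcome hn hE hδ hk⟩

theorem IsOutcome.exists_isUniqueOutcome_without_headstarts (hn : 2 ≤ n) (hE : E.Regular)
    (hδ : ∀ i, 0 < E.δ i ∧ E.δ i < 1) {Λ : (Fin n → ℝ≥0) → (Fin n → ℝ) → ℝ}
    (hΛ : EffortMonotone Λ) (h : IsOutcome E r x p) (hlt : ∀ i, p i < 1) :
    ∃ (r' : Rule n) (x' : Fin n → ℝ≥0), r'.k = 1 ∧ r'.β = 0 ∧ IsUniqueOutcome E r' x' p ∧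
      x ≤ x' ∧ Λ x p ≤ Λ x' p := by
  have hmem := h.mem_stdSimplex hn hE
  obtain ⟨r₁, -, hc₁, hrec₁⟩ := h.exists_isContestEq hn hE hδ
  obtain ⟨r', hk, hβ, hc, hrec⟩ := exists_isContestEq_contestEffort hn hE hmem hlt
  have hle := hc₁.le_contestEffort hE hrec₁ hlt
  have hu := hc.isUniqueOutcome hn hE hδ hk
  rw [hrec] at hu
  exact ⟨r', _, hk, hβ, hu, hle, hΛ.le_of_le hmem hle⟩

end

end Bargaining

end

theorem theorem2 {n : ℕ} (hn : 2 ≤ n) (E : Bargaining.Environment n) (hE : E.Regular)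
    (hδ : ∀ i, 0 < E.δ i ∧ E.δ i < 1)
    (Λ : (Fin n → NNReal) → (Fin n → ℝ) → ℝ) (hΛ : Bargaining.EffortMonotone Λ) :
    -- every equilibrium outcome under any rule is the unique one of a rule with `k = 1`
    (∀ r x p, Bargaining.IsOutcome E r x p →
      ∃ r' : Bargaining.Rule n, r'.k = 1 ∧ Bargaining.IsUniqueOutcome E r' x p) ∧
    -- unless some agent is recognized with certainty, a rule with `k = 1` and `β = 0` does at
    -- least as well, with the same recognition probabilities and weakly higher efforts
    (∀ r x p, Bargaining.IsOutcome E r x p → (∀ i, p i < 1) →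
      ∃ (r' : Bargaining.Rule n) (x' : Fin n → NNReal), r'.k = 1 ∧ r'.β = 0 ∧
        Bargaining.IsUniqueOutcome E r' x' p ∧ x ≤ x' ∧ Λ x p ≤ Λ x' p) ∧
    -- hence, if there is an optimum, there is one with `k = 1`, and one with `k = 1`, `β = 0`
    (∀ r x p, Bargaining.IsOptimal E Λ r x p →
      (∃ r' : Bargaining.Rule n, r'.k = 1 ∧ Bargaining.IsUniqueOutcome E r' x p ∧
        Bargaining.IsOptimal E Λ r' x p) ∧
      ((∀ i, p i < 1) → ∃ (r' : Bargaining.Rule n) (x' : Fin n → NNReal), r'.k = 1 ∧ r'.β = 0 ∧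
        Bargaining.IsUniqueOutcome E r' x' p ∧ Bargaining.IsOptimal E Λ r' x' p)) ∧
    -- for a continuous objective there is an optimum with `k = 1`, its headstarts can be taken to
    -- be zero unless some agent is recognized with certainty, and its value is in any case
    -- approached by rules with `k = 1` and `β = 0`
    (ContinuousOn (fun q : (Fin n → NNReal) × (Fin n → ℝ) => Λ q.1 q.2)
        (Set.univ ×ˢ stdSimplex ℝ (Fin n)) →
      ∃ (r : Bargaining.Rule n) (x : Fin n → NNReal) (p : Fin n → ℝ), r.k = 1 ∧
        Bargaining.IsUniqueOutcome E r x p ∧ Bargaining.IsOptimal E Λ r x p ∧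
        (r.β = 0 ∨ ∃ i, p i = 1) ∧
        ∀ ε > 0, ∃ (r' : Bargaining.Rule n) (x' : Fin n → NNReal) (p' : Fin n → ℝ),
          r'.k = 1 ∧ r'.β = 0 ∧ Bargaining.IsUniqueOutcome E r' x' p' ∧
          Λ x p - ε < Λ x' p') := by
  refine ⟨fun r x p h => h.exists_isUniqueOutcome hn hE hδ,
    fun r x p h hlt => h.exists_isUniqueOutcome_without_headstarts hn hE hδ hΛ hlt,
    fun r x p h => ⟨?_, fun hlt => ?_⟩, Bargaining.exists_optimal hn hE hδ hΛ⟩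
  · obtain ⟨r', hk, hu⟩ := h.1.exists_isUniqueOutcome hn hE hδ
    exact ⟨r', hk, hu, hu.1, h.2⟩
  · obtain ⟨r', x', hk, hβ, hu, -, hle⟩ :=
      h.1.exists_isUniqueOutcome_without_headstarts hn hE hδ hΛ hlt
    exact ⟨r', x', hk, hβ, hu, hu.1, fun r'' x'' p'' h'' => (h.2 r'' x'' p'' h'').trans hle⟩
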